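/- **Setting.** Kinds are $*$ and $\kappa_1\Rightarrow\kappa_2$. Type constructors (of System $\mathtt{F}_\omega$) are built, respecting kinds, from type constructor variables, the single constant $\mathtt{nat}:*$, application, abstraction $\lambda\alpha.\varphi$, and on kind $*$ the forms $\forall(\alpha:\kappa).\sigma$ and $\sigma\to\tau$; types are type constructors of kind $*$, $=_\beta$ is $\beta$-conversion and $\mathrm{nf}_\beta$ the $\beta$-normal form. Put $\chi_*=\mathtt{nat}$ and $\chi_{\kappa_1\Rightarrow\kappa_2}=\lambda\alpha{:}\kappa_1.\chi_{\kappa_2}$. *Interpretation terms* are the (Church-style) $\mathtt{F}_\omega$-terms, taken modulo $\beta$-conversion in types, over the constants $n:\mathtt{nat}$ ($n\in\mathbb N$), $\oplus,\otimes:\forall\alpha.\alpha\to\alpha\to\alpha$, $\mathtt{flatten}:\forall\alpha.\alpha\to\mathtt{nat}$, $\mathtt{lift}:\forall\alpha.\mathtt{nat}\to\alpha$. A subscript $\sigma$ denotes application of a constant to the type $\sigma$; $\oplus_\sigma,\otimes_\sigma$ are written infix and associate to the left. The relation $\leadsto$ is the compatible closure of term and type $\beta$-reduction and of the rules (with $\circ\in\{\oplus,\otimes\}$)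 $$n\oplus_{\mathtt{nat}}m\leadsto n+m,\qquad n\otimes_{\mathtt{nat}}m\leadsto nm,\qquad s\circ_{\sigma\to\tau}t\leadsto\lambda x{:}\sigma.\,(s\,x)\circ_\tau(t\,x),\qquad s\circ_{\forall\alpha.\sigma}t\leadsto\Lambda\alpha.\,(s\,\alpha)\circ_\sigma(t\,\alpha),$$ $$\mathtt{flatten}_{\mathtt{nat}}\,s\leadsto s,\qquad \mathtt{flatten}_{\sigma\to\tau}\,s\leadsto\mathtt{flatten}_\tau(s(\mathtt{lift}_\sigma 0)),\qquad \mathtt{flatten}_{\forall(\alpha:\kappa).\sigma}\,s\leadsto\mathtt{flatten}_{\sigma[\alpha:=\chi_\kappa]}(s\,\chi_\kappa),$$ $$\mathtt{lift}_{\mathtt{nat}}\,s\leadsto s,\qquad \mathtt{lift}_{\sigma\to\tau}\,s\leadsto\lambda x{:}\sigma.\,\mathtt{lift}_\tau\,s,\qquad \mathtt{lift}_{\forall\alpha.\sigma}\,s\leadsto\Lambda\alpha.\,\mathtt{lift}_\sigma\,s .$$ For $(\succ,>)$ and $(\succeq,\ge)$ respectively, the relation $R$ on closed terms of closed $\beta$-normal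 type is the largest relation such that $s\mathrel{R_\sigma}t$ implies one of: - $\sigma=\mathtt{nat}$ and the normal forms of $s,t$ are natural numbers standing in the relation $>$ (resp. $\ge$); - $\sigma=\tau_1\to\tau_2$ and $s\,q\mathrel{R_{\tau_2}}t\,q$ for all closed $\leadsto$-normal terms $q:\tau_1$; - $\sigma=\forall(\alpha:\kappa).\rho$ and $s\,\tau\mathrel{R_{\mathrm{nf}_\beta(\rho[\alpha:=\tau])}}t\,\tau$ for all closed $\tau$ of kind $\kappa$. Closed $s,t$ satisfy $s\approx t$ iff $s\succeq t$ and $t\succeq s$. For arbitrary terms $s,t$ of a type $\sigma$, possibly with free variables, each relation holds at $\sigma$ iff it holds between $\mathcal C(s)$ and $\mathcal C(t)$ at $\mathrm{nf}_\beta(\mathcal C(\sigma))$ for every closure $\mathcal C$, i.e. every well-typed substitution of closed type constructors and closed terms for the free variables. **Statement.** Let $\sigma$ be any type and $s,t,u$ any interpretation terms of type $\sigma$. All relations are at type $\sigma$ unless indicated. 1. $s\oplus_\sigma t\approx t\oplus_\sigma s$ and $s\otimes_\sigma t\approx t\otimes_\sigma s$; $s\oplus_\sigma(t\oplus_\sigma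 u)\approx(s\oplus_\sigma t)\oplus_\sigma u$ and $s\otimes_\sigma(t\otimes_\sigma u)\approx(s\otimes_\sigma t)\otimes_\sigma u$; $s\otimes_\sigma(t\oplus_\sigma u)\approx(s\otimes_\sigma t)\oplus_\sigma(s\otimes_\sigma u)$; $(\mathtt{lift}_\sigma 0)\oplus_\sigma s\approx s$ and $(\mathtt{lift}_\sigma 1)\otimes_\sigma s\approx s$. 2. For all natural numbers $n,m$: $\mathtt{lift}_\sigma(n+m)\approx\mathtt{lift}_\sigma n\oplus_\sigma\mathtt{lift}_\sigma m$, $\mathtt{lift}_\sigma(nm)\approx\mathtt{lift}_\sigma n\otimes_\sigma\mathtt{lift}_\sigma m$ and $\mathtt{flatten}_\sigma(\mathtt{lift}_\sigma n)\approx_{\mathtt{nat}}n$. The same holds for arbitrary terms $n,m$ of type $\mathtt{nat}$, with $n\oplus_{\mathtt{nat}}m$ and $n\otimes_{\mathtt{nat}}m$ in place of $n+m$ and $nm$. 3. $s\oplus_\sigma t\succeq s$ and $s\oplus_\sigma t\succeq t$; and for every natural number $n>0$, $s\oplus_\sigma\mathtt{lift}_\sigma n\succ s$ and $\mathtt{lift}_\sigma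 n\oplus_\sigma t\succ t$. 4. If $s\succeq t$, then $s\oplus_\sigma u\succeq t\oplus_\sigma u$, $u\oplus_\sigma s\succeq u\oplus_\sigma t$, $s\otimes_\sigma u\succeq t\otimes_\sigma u$ and $u\otimes_\sigma s\succeq u\otimes_\sigma t$. If $s\succ t$, then $s\oplus_\sigma u\succ t\oplus_\sigma u$ and $u\oplus_\sigma s\succ u\oplus_\sigma t$; if additionally $u\succeq\mathtt{lift}_\sigma 1$, then also $s\otimes_\sigma u\succ t\otimes_\sigma u$ and $u\otimes_\sigma s\succ u\otimes_\sigma t$. 5. (Absolute positiveness.) Let $1\le k\le n$ and let $s_1,\dots,s_n,t_1,\dots,t_k$ be terms of type $\sigma$ with $s\approx s_1\oplus_\sigma\cdots\oplus_\sigma s_n$, $t\approx t_1\oplus_\sigma\cdots\oplus_\sigma t_k$ and $s_i\succeq t_i$ for all $i\le k$. Then $s\succeq t$; and if moreover $s_1\succ t_1$, then $s\succ t$. -/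

import Mathlib

namespace InterpTerms

/-! ## Kinds, type constructors, types

Variables are de Bruijn indices. `Ty Γ κ` is the set of type constructors of kind `κ` over the
single type constant `nat : ∗` whose free type constructor variables are declared, with their
kinds, in the list `Γ`. Thus `Ty [] κ` is the set of closed type constructors of kind `κ`. -/

inductive Kind : Type
  | star : Kind
  | arr : Kind → Kind → Kind

/-- Type constructor variables of kind `κ` declared in `Γ`. -/
inductive TVar : List Kind → Kind → Type
  | zero {Γ : List Kind} {κ : Kind} : TVar (κ :: Γ) κ
  | succ {Γ : List Kind} {κ κ' : Kind} : TVar Γ κ → TVar (κ' :: Γ) κ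

inductive Ty : List Kind → Kind → Type
  | var {Γ : List Kind} {κ : Kind} : TVar Γ κ → Ty Γ κ
  | nat {Γ : List Kind} : Ty Γ Kind.star
  | app {Γ : List Kind} {κ₁ κ₂ : Kind} : Ty Γ (Kind.arr κ₁ κ₂) → Ty Γ κ₁ → Ty Γ κ₂
  | lam {Γ : List Kind} {κ₁ κ₂ : Kind} : Ty (κ₁ :: Γ) κ₂ → Ty Γ (Kind.arr κ₁ κ₂)
  | all {Γ : List Kind} (κ : Kind) : Ty (κ :: Γ) Kind.star → Ty Γ Kind.star
  | arrow {Γ : List Kind} : Ty Γ Kind.star → Ty Γ Kind.star → Ty Γ Kind.star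

/-- Types are the type constructors of kind `∗`. -/
abbrev Typ (Γ : List Kind) : Type := Ty Γ Kind.star

/-- Renamings of type constructor variables. -/
def TRen (Γ Γ' : List Kind) : Type := ∀ κ : Kind, TVar Γ κ → TVar Γ' κ

def TRen.up {Γ Γ' : List Kind} (ρ : TRen Γ Γ') (κ' : Kind) : TRen (κ' :: Γ) (κ' :: Γ')
  | _, TVar.zero => TVar.zero
  | κ, TVar.succ x => TVar.succ (ρ κ x)

def TRen.wk {Γ : List Kind} (κ' : Kind) : TRen Γ (κ' :: Γ) := fun _ x => TVar.succ x

def Ty.ren {Γ Γ' : List Kind} {κ : Kind} (ρ : TRen Γ Γ') : Ty Γ κ → Ty Γ' κ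
  | .var x => .var (ρ _ x)
  | .nat => .nat
  | .app f a => .app (f.ren ρ) (a.ren ρ)
  | .lam b => .lam (b.ren (ρ.up _))
  | .all κ b => .all κ (b.ren (ρ.up κ))
  | .arrow a b => .arrow (a.ren ρ) (b.ren ρ)

/-- Kind-preserving simultaneous substitutions of type constructors for variables. -/
def TSub (Γ Γ' : List Kind) : Type := ∀ κ : Kind, TVar Γ κ → Ty Γ' κ

def TSub.up {Γ Γ' : List Kind} (θ : TSub Γ Γ') (κ' : Kind) : TSub (κ' :: Γ) (κ' :: Γ')
  | _, TVar.zero => .var TVar.zero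
  | κ, TVar.succ x => (θ κ x).ren (TRen.wk κ')

/-- Capture-avoiding simultaneous substitution. -/
def Ty.sub {Γ Γ' : List Kind} {κ : Kind} (θ : TSub Γ Γ') : Ty Γ κ → Ty Γ' κ
  | .var x => θ _ x
  | .nat => .nat
  | .app f a => .app (f.sub θ) (a.sub θ)
  | .lam b => .lam (b.sub (θ.up _))
  | .all κ b => .all κ (b.sub (θ.up κ))
  | .arrow a b => .arrow (a.sub θ) (b.sub θ)

/-- The substitution `[α := τ]` for the most recently declared variable `α`. -/
def TSub.one {Γ : List Kind} {κ' : Kind} (τ : Ty Γ κ') : TSub (κ' :: Γ) Γ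
  | _, TVar.zero => τ
  | _, TVar.succ x => .var x

/-- `σ[α := τ]`. -/
def Ty.inst {Γ : List Kind} {κ' κ : Kind} (σ : Ty (κ' :: Γ) κ) (τ : Ty Γ κ') : Ty Γ κ :=
  σ.sub (TSub.one τ)

/-- One step of β-reduction on type constructors. -/
inductive Ty.Beta : {Γ : List Kind} → {κ : Kind} → Ty Γ κ → Ty Γ κ → Prop
  | beta {Γ : List Kind} {κ₁ κ₂ : Kind} (b : Ty (κ₁ :: Γ) κ₂) (a : Ty Γ κ₁) :
      Ty.Beta (.app (.lam b) a) (b.inst a)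
  | appL {Γ : List Kind} {κ₁ κ₂ : Kind} {f f' : Ty Γ (Kind.arr κ₁ κ₂)} (a : Ty Γ κ₁) :
      Ty.Beta f f' → Ty.Beta (.app f a) (.app f' a)
  | appR {Γ : List Kind} {κ₁ κ₂ : Kind} (f : Ty Γ (Kind.arr κ₁ κ₂)) {a a' : Ty Γ κ₁} :
      Ty.Beta a a' → Ty.Beta (.app f a) (.app f a')
  | lam {Γ : List Kind} {κ₁ κ₂ : Kind} {b b' : Ty (κ₁ :: Γ) κ₂} :
      Ty.Beta b b' → Ty.Beta (.lam b) (.lam b')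
  | all {Γ : List Kind} (κ : Kind) {b b' : Ty (κ :: Γ) Kind.star} :
      Ty.Beta b b' → Ty.Beta (.all κ b) (.all κ b')
  | arrowL {Γ : List Kind} {a a' : Typ Γ} (b : Typ Γ) :
      Ty.Beta a a' → Ty.Beta (.arrow a b) (.arrow a' b)
  | arrowR {Γ : List Kind} (a : Typ Γ) {b b' : Typ Γ} :
      Ty.Beta b b' → Ty.Beta (.arrow a b) (.arrow a b')

/-- `σ =β τ`. -/
def Ty.BetaEq {Γ : List Kind} {κ : Kind} : Ty Γ κ → Ty Γ κ → Prop := Relation.EqvGen Ty.Beta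

/-- `σ →β* τ`. -/
def Ty.BetaStar {Γ : List Kind} {κ : Kind} : Ty Γ κ → Ty Γ κ → Prop :=
  Relation.ReflTransGen Ty.Beta

def Ty.IsLam {Γ : List Kind} {κ : Kind} : Ty Γ κ → Prop
  | .lam _ => True
  | _ => False

/-- β-normal: no subexpression `(λα.φ)ψ`. -/
def Ty.IsNormal {Γ : List Kind} {κ : Kind} : Ty Γ κ → Prop
  | .var _ => True
  | .nat => True
  | .app f a => ¬ f.IsLam ∧ f.IsNormal ∧ a.IsNormal
  | .lam b => b.IsNormal
  | .all _ b => b.IsNormal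
  | .arrow a b => a.IsNormal ∧ b.IsNormal

/-! ### Existence of β-normal forms -/

theorem Ty.BetaStar.app {Γ : List Kind} {κ₁ κ₂ : Kind} {f f' : Ty Γ (Kind.arr κ₁ κ₂)}
    {a a' : Ty Γ κ₁} (hf : f.BetaStar f') (ha : a.BetaStar a') :
    (Ty.app f a).BetaStar (Ty.app f' a') :=
  (Relation.ReflTransGen.lift (fun x => Ty.app x a) (fun _ _ h => Ty.Beta.appL a h) _ _ hf).trans
    (Relation.ReflTransGen.lift (fun x => Ty.app f' x) (fun _ _ h => Ty.Beta.appR f' h) _ _ ha)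

theorem Ty.BetaStar.arrow {Γ : List Kind} {a a' b b' : Typ Γ}
    (ha : a.BetaStar a') (hb : b.BetaStar b') :
    (Ty.arrow a b).BetaStar (Ty.arrow a' b') :=
  (Relation.ReflTransGen.lift (fun x => Ty.arrow x b) (fun _ _ h => Ty.Beta.arrowL b h) _ _ ha).trans
    (Relation.ReflTransGen.lift (fun x => Ty.arrow a' x) (fun _ _ h => Ty.Beta.arrowR a' h) _ _ hb)

theorem Ty.BetaStar.lam {Γ : List Kind} {κ₁ κ₂ : Kind} {b b' : Ty (κ₁ :: Γ) κ₂}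
    (h : b.BetaStar b') : (Ty.lam b).BetaStar (Ty.lam b') :=
  Relation.ReflTransGen.lift Ty.lam (fun _ _ h => Ty.Beta.lam h) _ _ h

theorem Ty.BetaStar.all {Γ : List Kind} {κ : Kind} {b b' : Ty (κ :: Γ) Kind.star}
    (h : b.BetaStar b') : (Ty.all κ b).BetaStar (Ty.all κ b') :=
  Relation.ReflTransGen.lift (Ty.all κ) (fun _ _ h => Ty.Beta.all κ h) _ _ h

theorem Ty.isLam_ren {Γ : List Kind} {κ : Kind} (t : Ty Γ κ) {Γ' : List Kind} (ρ : TRen Γ Γ') :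
    (t.ren ρ).IsLam ↔ t.IsLam := by
  cases t <;> simp [Ty.ren, Ty.IsLam]

theorem Ty.IsNormal.ren {Γ : List Kind} {κ : Kind} (t : Ty Γ κ) :
    ∀ {Γ' : List Kind} (ρ : TRen Γ Γ'), t.IsNormal → (t.ren ρ).IsNormal := by
  induction t with
  | var x => intros; trivial
  | nat => intros; trivial
  | app f a ihf iha =>
    intro Γ' ρ h
    exact ⟨fun hl => h.1 ((Ty.isLam_ren f ρ).1 hl), ihf ρ h.2.1, iha ρ h.2.2⟩
  | lam b ih => intro Γ' ρ h; exact ih (ρ.up _) h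
  | all κ b ih => intro Γ' ρ h; exact ih (ρ.up _) h
  | arrow a b iha ihb => intro Γ' ρ h; exact ⟨iha ρ h.1, ihb ρ h.2⟩

def Kind.size : Kind → ℕ
  | .star => 0
  | .arr κ₁ κ₂ => κ₁.size + κ₂.size + 1

/-- A substitution of normal type constructors, where only variables of kinds of size at most `N`
may be replaced by something other than a variable. -/
def TSub.Bounded {Γ Γ' : List Kind} (N : ℕ) (θ : TSub Γ Γ') : Prop :=
  ∀ (κ : Kind) (x : TVar Γ κ), (θ κ x).IsNormal ∧ ((∃ y, θ κ x = .var y) ∨ κ.size ≤ N)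

theorem TSub.Bounded.up {Γ Γ' : List Kind} {N : ℕ} {θ : TSub Γ Γ'} (h : θ.Bounded N)
    (κ' : Kind) : (θ.up κ').Bounded N := by
  intro κ x
  cases x with
  | zero => exact ⟨trivial, Or.inl ⟨_, rfl⟩⟩
  | succ x =>
    refine ⟨Ty.IsNormal.ren _ _ (h κ x).1, (h κ x).2.imp ?_ id⟩
    rintro ⟨y, hy⟩
    exact ⟨TVar.succ y, by simp [TSub.up, hy, Ty.ren, TRen.wk]⟩

theorem TSub.bounded_one {Γ : List Kind} {κ' : Kind} {τ : Ty Γ κ'} (h : τ.IsNormal) :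
    (TSub.one τ).Bounded κ'.size := by
  intro κ x
  cases x with
  | zero => exact ⟨h, Or.inr le_rfl⟩
  | succ x => exact ⟨trivial, Or.inl ⟨x, rfl⟩⟩

theorem Ty.exists_nf_sub (N : ℕ) : ∀ {Γ : List Kind} {κ : Kind} (t : Ty Γ κ) {Γ' : List Kind}
    (θ : TSub Γ Γ'), θ.Bounded N → t.IsNormal →
    ∃ t' : Ty Γ' κ, (t.sub θ).BetaStar t' ∧ t'.IsNormal ∧
      (¬ t.IsLam → t'.IsLam → κ.size ≤ N) := by
  induction N using Nat.strong_induction_on with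
  | _ N ihN =>
  intro Γ κ t
  induction t with
  | var x =>
    intro Γ' θ hθ _
    refine ⟨θ _ x, .refl, (hθ _ x).1, fun _ hl => ?_⟩
    rcases (hθ _ x).2 with ⟨y, hy⟩ | hs
    · rw [hy] at hl; exact hl.elim
    · exact hs
  | nat => intro Γ' θ _ _; exact ⟨.nat, .refl, trivial, fun _ hl => hl.elim⟩
  | @app Γ κ₁ κ₂ f a ihf iha =>
    intro Γ' θ hθ h
    obtain ⟨f', hf, nf, lf⟩ := ihf θ hθ h.2.1
    obtain ⟨a', ha, na, -⟩ := iha θ hθ h.2.2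
    by_cases hl : f'.IsLam
    · have hs := lf h.1 hl
      simp only [Kind.size] at hs
      cases f' with
      | lam b =>
        obtain ⟨c, hc, nc, -⟩ := ihN κ₁.size (by omega) b (TSub.one a')
          (TSub.bounded_one na) nf
        exact ⟨c, (Ty.BetaStar.app hf ha).trans (.head (Ty.Beta.beta b a') hc), nc,
          fun _ _ => by omega⟩
      | _ => exact hl.elim
    · exact ⟨.app f' a', Ty.BetaStar.app hf ha, ⟨hl, nf, na⟩, fun _ hl => hl.elim⟩
  | lam b ih =>
    intro Γ' θ hθ h
    obtain ⟨b', hb, nb, -⟩ := ih (θ.up _) (hθ.up _) h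
    exact ⟨.lam b', hb.lam, nb, fun hl => (hl trivial).elim⟩
  | all κ b ih =>
    intro Γ' θ hθ h
    obtain ⟨b', hb, nb, -⟩ := ih (θ.up _) (hθ.up _) h
    exact ⟨.all κ b', hb.all, nb, fun _ hl => hl.elim⟩
  | arrow a b iha ihb =>
    intro Γ' θ hθ h
    obtain ⟨a', ha, na, -⟩ := iha θ hθ h.1
    obtain ⟨b', hb, nb, -⟩ := ihb θ hθ h.2
    exact ⟨.arrow a' b', ha.arrow hb, ⟨na, nb⟩, fun _ hl => hl.elim⟩

theorem Ty.exists_nf {Γ : List Kind} {κ : Kind} (t : Ty Γ κ) :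
    ∃ t' : Ty Γ κ, t.BetaStar t' ∧ t'.IsNormal := by
  induction t with
  | var x => exact ⟨.var x, .refl, trivial⟩
  | nat => exact ⟨.nat, .refl, trivial⟩
  | app f a ihf iha =>
    obtain ⟨f', hf, nf⟩ := ihf
    obtain ⟨a', ha, na⟩ := iha
    by_cases hl : f'.IsLam
    · cases f' with
      | lam b =>
        obtain ⟨c, hc, nc, -⟩ := Ty.exists_nf_sub _ b (TSub.one a') (TSub.bounded_one na) nf
        exact ⟨c, (Ty.BetaStar.app hf ha).trans (.head (Ty.Beta.beta b a') hc), nc⟩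
      | _ => exact hl.elim
    · exact ⟨.app f' a', Ty.BetaStar.app hf ha, hl, nf, na⟩
  | lam b ih => obtain ⟨b', hb, nb⟩ := ih; exact ⟨.lam b', hb.lam, nb⟩
  | all κ b ih => obtain ⟨b', hb, nb⟩ := ih; exact ⟨.all κ b', hb.all, nb⟩
  | arrow a b iha ihb =>
    obtain ⟨a', ha, na⟩ := iha
    obtain ⟨b', hb, nb⟩ := ihb
    exact ⟨.arrow a' b', ha.arrow hb, na, nb⟩

/-- The β-normal form of a type constructor. -/
noncomputable def Ty.nf {Γ : List Kind} {κ : Kind} (t : Ty Γ κ) : Ty Γ κ := t.exists_nf.choose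

theorem Ty.nf_spec {Γ : List Kind} {κ : Kind} (t : Ty Γ κ) : t.BetaStar t.nf ∧ t.nf.IsNormal :=
  t.exists_nf.choose_spec

/-- `χ_∗ = nat` and `χ_{κ₁ ⇒ κ₂} = λα:κ₁. χ_{κ₂}`. -/
def Ty.chi : {Γ : List Kind} → (κ : Kind) → Ty Γ κ
  | _, .star => .nat
  | _, .arr _ κ₂ => .lam (Ty.chi κ₂)

/-! ## Interpretation terms -/

/-- The function symbols other than the natural numbers. -/
inductive Sym : Type
  | plus : Sym
  | times : Sym
  | flatten : Sym
  | lift : Sym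

/-- `⊕, ⊗ : ∀α. α → α → α`, `flatten : ∀α. α → nat`, `lift : ∀α. nat → α`. -/
def Sym.type {Γ : List Kind} : Sym → Typ Γ
  | .plus => .all .star (.arrow (.var .zero) (.arrow (.var .zero) (.var .zero)))
  | .times => .all .star (.arrow (.var .zero) (.arrow (.var .zero) (.var .zero)))
  | .flatten => .all .star (.arrow (.var .zero) .nat)
  | .lift => .all .star (.arrow .nat (.var .zero))

/-- Raw expressions with type constructor variables in `Γ`; term variables are de Bruijn
indices. The preterms are the expressions that are typable (`HasType` below). -/
inductive Tm : List Kind → Type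
  | var {Γ : List Kind} (i : ℕ) : Tm Γ
  | num {Γ : List Kind} (n : ℕ) : Tm Γ
  | sym {Γ : List Kind} (f : Sym) : Tm Γ
  | abs {Γ : List Kind} (σ : Typ Γ) (s : Tm Γ) : Tm Γ
  | tabs {Γ : List Kind} (κ : Kind) (s : Tm (κ :: Γ)) : Tm Γ
  | app {Γ : List Kind} (s t : Tm Γ) : Tm Γ
  | tapp {Γ : List Kind} {κ : Kind} (s : Tm Γ) (τ : Ty Γ κ) : Tm Γ

/-- Typing. `Δ` lists the types of the free term variables. In the rule for `Λα. s` the context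
of `s` is weakened, so `α` does not occur in the type of a free variable of `s`. -/
inductive HasType : {Γ : List Kind} → List (Typ Γ) → Tm Γ → Typ Γ → Prop
  | var {Γ : List Kind} {Δ : List (Typ Γ)} {i : ℕ} {σ : Typ Γ} :
      Δ[i]? = some σ → HasType Δ (.var i) σ
  | num {Γ : List Kind} {Δ : List (Typ Γ)} (n : ℕ) : HasType Δ (.num n) .nat
  | sym {Γ : List Kind} {Δ : List (Typ Γ)} (f : Sym) : HasType Δ (.sym f) f.type
  | abs {Γ : List Kind} {Δ : List (Typ Γ)} {σ τ : Typ Γ} {s : Tm Γ} :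
      HasType (σ :: Δ) s τ → HasType Δ (.abs σ s) (.arrow σ τ)
  | tabs {Γ : List Kind} {Δ : List (Typ Γ)} {κ : Kind} {σ : Typ (κ :: Γ)} {s : Tm (κ :: Γ)} :
      HasType (Δ.map (Ty.ren (TRen.wk κ))) s σ → HasType Δ (.tabs κ s) (.all κ σ)
  | app {Γ : List Kind} {Δ : List (Typ Γ)} {σ τ : Typ Γ} {s t : Tm Γ} :
      HasType Δ s (.arrow σ τ) → HasType Δ t σ → HasType Δ (.app s t) τ
  | tapp {Γ : List Kind} {Δ : List (Typ Γ)} {κ : Kind} {σ : Typ (κ :: Γ)} {s : Tm Γ}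
      (τ : Ty Γ κ) : HasType Δ s (.all κ σ) → HasType Δ (.tapp s τ) (σ.inst τ)
  | conv {Γ : List Kind} {Δ : List (Typ Γ)} {σ τ : Typ Γ} {s : Tm Γ} :
      HasType Δ s τ → τ.BetaEq σ → HasType Δ s σ

/-- `s ≡ t`: identity modulo β-conversion in types. A term is an `≡`-class of preterms; here
terms are given by representatives, and reduction is defined modulo `≡`. -/
inductive Tm.Equiv : {Γ : List Kind} → Tm Γ → Tm Γ → Prop
  | var {Γ : List Kind} (i : ℕ) : Tm.Equiv (.var i : Tm Γ) (.var i)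
  | num {Γ : List Kind} (n : ℕ) : Tm.Equiv (.num n : Tm Γ) (.num n)
  | sym {Γ : List Kind} (f : Sym) : Tm.Equiv (.sym f : Tm Γ) (.sym f)
  | abs {Γ : List Kind} {σ σ' : Typ Γ} {s s' : Tm Γ} :
      σ.BetaEq σ' → Tm.Equiv s s' → Tm.Equiv (.abs σ s) (.abs σ' s')
  | tabs {Γ : List Kind} (κ : Kind) {s s' : Tm (κ :: Γ)} :
      Tm.Equiv s s' → Tm.Equiv (.tabs κ s) (.tabs κ s')
  | app {Γ : List Kind} {s s' t t' : Tm Γ} :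
      Tm.Equiv s s' → Tm.Equiv t t' → Tm.Equiv (.app s t) (.app s' t')
  | tapp {Γ : List Kind} {κ : Kind} {s s' : Tm Γ} {τ τ' : Ty Γ κ} :
      Tm.Equiv s s' → τ.BetaEq τ' → Tm.Equiv (.tapp s τ) (.tapp s' τ')

/-! ### Substitution in terms -/

/-- Renaming of type constructor variables in a term. -/
def Tm.tren {Γ Γ' : List Kind} (ρ : TRen Γ Γ') : Tm Γ → Tm Γ'
  | .var i => .var i
  | .num n => .num n
  | .sym f => .sym f
  | .abs σ s => .abs (σ.ren ρ) (s.tren ρ)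
  | .tabs κ s => .tabs κ (s.tren (ρ.up κ))
  | .app s t => .app (s.tren ρ) (t.tren ρ)
  | .tapp s τ => .tapp (s.tren ρ) (τ.ren ρ)

/-- Substitution of type constructors in a term. -/
def Tm.tsub {Γ Γ' : List Kind} (θ : TSub Γ Γ') : Tm Γ → Tm Γ'
  | .var i => .var i
  | .num n => .num n
  | .sym f => .sym f
  | .abs σ s => .abs (σ.sub θ) (s.tsub θ)
  | .tabs κ s => .tabs κ (s.tsub (θ.up κ))
  | .app s t => .app (s.tsub θ) (t.tsub θ)
  | .tapp s τ => .tapp (s.tsub θ) (τ.sub θ)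

def upRen (ρ : ℕ → ℕ) : ℕ → ℕ
  | 0 => 0
  | i + 1 => ρ i + 1

/-- Renaming of term variables. -/
def Tm.ren {Γ : List Kind} (ρ : ℕ → ℕ) : Tm Γ → Tm Γ
  | .var i => .var (ρ i)
  | .num n => .num n
  | .sym f => .sym f
  | .abs σ s => .abs σ (s.ren (upRen ρ))
  | .tabs κ s => .tabs κ (s.ren ρ)
  | .app s t => .app (s.ren ρ) (t.ren ρ)
  | .tapp s τ => .tapp (s.ren ρ) τ

/-- Weakening by a fresh term variable. -/
def Tm.wk {Γ : List Kind} (s : Tm Γ) : Tm Γ := s.ren Nat.succ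

/-- Weakening by a fresh type constructor variable. -/
def Tm.twk {Γ : List Kind} (κ : Kind) (s : Tm Γ) : Tm (κ :: Γ) := s.tren (TRen.wk κ)

def upSub {Γ : List Kind} (γ : ℕ → Tm Γ) : ℕ → Tm Γ
  | 0 => .var 0
  | i + 1 => (γ i).wk

/-- Capture-avoiding simultaneous substitution of terms for term variables. -/
def Tm.sub {Γ : List Kind} (γ : ℕ → Tm Γ) : Tm Γ → Tm Γ
  | .var i => γ i
  | .num n => .num n
  | .sym f => .sym f
  | .abs σ s => .abs σ (s.sub (upSub γ))
  | .tabs κ s => .tabs κ (s.sub (fun i => (γ i).twk κ))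
  | .app s t => .app (s.sub γ) (t.sub γ)
  | .tapp s τ => .tapp (s.sub γ) τ

/-- `s[x := t]` for the most recently bound variable `x`. -/
def Tm.inst {Γ : List Kind} (s t : Tm Γ) : Tm Γ :=
  s.sub fun i => match i with
    | 0 => t
    | i + 1 => .var i

/-- `s[α := τ]` for the most recently bound type constructor variable `α`. -/
def Tm.tinst {Γ : List Kind} {κ : Kind} (s : Tm (κ :: Γ)) (τ : Ty Γ κ) : Tm Γ :=
  s.tsub (TSub.one τ)

/-! ### The operations -/

/-- `f_σ s t`, used for the binary symbols `f = ⊕` and `f = ⊗`. -/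
def circ {Γ : List Kind} (f : Sym) (σ : Typ Γ) (s t : Tm Γ) : Tm Γ :=
  .app (.app (.tapp (.sym f) σ) s) t

/-- `s ⊕_σ t`. -/
def oplus {Γ : List Kind} (σ : Typ Γ) (s t : Tm Γ) : Tm Γ := circ .plus σ s t

/-- `s ⊗_σ t`. -/
def otimes {Γ : List Kind} (σ : Typ Γ) (s t : Tm Γ) : Tm Γ := circ .times σ s t

/-- `flatten_σ s`. -/
def flatten {Γ : List Kind} (σ : Typ Γ) (s : Tm Γ) : Tm Γ := .app (.tapp (.sym .flatten) σ) s

/-- `lift_σ s`. -/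
def lift {Γ : List Kind} (σ : Typ Γ) (s : Tm Γ) : Tm Γ := .app (.tapp (.sym .lift) σ) s

/-- The left-associated sum `s₁ ⊕_σ s₂ ⊕_σ ⋯ ⊕_σ sₙ` of a nonempty sequence with head `s₁` and
tail `[s₂, …, sₙ]`. -/
def osum {Γ : List Kind} (σ : Typ Γ) (s₁ : Tm Γ) (ss : List (Tm Γ)) : Tm Γ :=
  ss.foldl (oplus σ) s₁

/-! ### Reduction -/

/-- One reduction step between representatives. -/
inductive Tm.PreStep : {Γ : List Kind} → Tm Γ → Tm Γ → Prop
  | abs {Γ : List Kind} (σ : Typ Γ) {s t : Tm Γ} :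
      Tm.PreStep s t → Tm.PreStep (.abs σ s) (.abs σ t)
  | tabs {Γ : List Kind} (κ : Kind) {s t : Tm (κ :: Γ)} :
      Tm.PreStep s t → Tm.PreStep (.tabs κ s) (.tabs κ t)
  | appR {Γ : List Kind} (u : Tm Γ) {s t : Tm Γ} :
      Tm.PreStep s t → Tm.PreStep (.app u s) (.app u t)
  | appL {Γ : List Kind} (u : Tm Γ) {s t : Tm Γ} :
      Tm.PreStep s t → Tm.PreStep (.app s u) (.app t u)
  | tapp {Γ : List Kind} {κ : Kind} (τ : Ty Γ κ) {s t : Tm Γ} :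
      Tm.PreStep s t → Tm.PreStep (.tapp s τ) (.tapp t τ)
  | beta {Γ : List Kind} (σ : Typ Γ) (s t : Tm Γ) :
      Tm.PreStep (.app (.abs σ s) t) (s.inst t)
  | tbeta {Γ : List Kind} {κ : Kind} (s : Tm (κ :: Γ)) (τ : Ty Γ κ) :
      Tm.PreStep (.tapp (.tabs κ s) τ) (s.tinst τ)
  | plus_nat {Γ : List Kind} (n m : ℕ) :
      Tm.PreStep (oplus .nat (.num n) (.num m) : Tm Γ) (.num (n + m))
  | times_nat {Γ : List Kind} (n m : ℕ) :
      Tm.PreStep (otimes .nat (.num n) (.num m) : Tm Γ) (.num (n * m))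
  | circ_arrow {Γ : List Kind} (f : Sym) (hf : f = .plus ∨ f = .times) (σ τ : Typ Γ)
      (s t : Tm Γ) :
      Tm.PreStep (circ f (.arrow σ τ) s t)
        (.abs σ (circ f τ (.app s.wk (.var 0)) (.app t.wk (.var 0))))
  | circ_all {Γ : List Kind} (f : Sym) (hf : f = .plus ∨ f = .times) (κ : Kind)
      (σ : Typ (κ :: Γ)) (s t : Tm Γ) :
      Tm.PreStep (circ f (.all κ σ) s t)
        (.tabs κ (circ f σ (.tapp (s.twk κ) (.var TVar.zero : Ty (κ :: Γ) κ))
          (.tapp (t.twk κ) (.var TVar.zero : Ty (κ :: Γ) κ))))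
  | flatten_nat {Γ : List Kind} (s : Tm Γ) : Tm.PreStep (flatten .nat s) s
  | flatten_arrow {Γ : List Kind} (σ τ : Typ Γ) (s : Tm Γ) :
      Tm.PreStep (flatten (.arrow σ τ) s) (flatten τ (.app s (lift σ (.num 0))))
  | flatten_all {Γ : List Kind} (κ : Kind) (σ : Typ (κ :: Γ)) (s : Tm Γ) :
      Tm.PreStep (flatten (.all κ σ) s)
        (flatten (σ.inst (Ty.chi κ)) (.tapp s (Ty.chi κ : Ty Γ κ)))
  | lift_nat {Γ : List Kind} (s : Tm Γ) : Tm.PreStep (lift .nat s) s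
  | lift_arrow {Γ : List Kind} (σ τ : Typ Γ) (s : Tm Γ) :
      Tm.PreStep (lift (.arrow σ τ) s) (.abs σ (lift τ s.wk))
  | lift_all {Γ : List Kind} (κ : Kind) (σ : Typ (κ :: Γ)) (s : Tm Γ) :
      Tm.PreStep (lift (.all κ σ) s) (.tabs κ (lift σ (s.twk κ)))

/-- The reduction relation `s ⇝ t` on `≡`-classes. -/
def Tm.Step {Γ : List Kind} (s t : Tm Γ) : Prop :=
  ∃ s' t' : Tm Γ, s.Equiv s' ∧ s'.PreStep t' ∧ t'.Equiv t

/-- `s` is in normal form with respect to `⇝`. -/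
def Tm.IsNormal {Γ : List Kind} (s : Tm Γ) : Prop := ∀ t : Tm Γ, ¬ s.Step t

/-- `s` is a final interpretation term of the closed type `σ`: closed and in normal form. -/
def IsFinal (σ : Typ []) (s : Tm []) : Prop := HasType [] s σ ∧ s.IsNormal

/-- The normal form of the closed term `s` is the natural number `n`: `s ⇝* n`
(natural numbers are in normal form, and are `≡` only to themselves). -/
def Tm.EvalsTo (s : Tm []) (n : ℕ) : Prop := Relation.ReflTransGen Tm.Step s (.num n)

/-! ## The orderings -/

/-- `R` is consistent with the three rules that define the ordering on closed terms of closed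
β-normal types coinductively; `r` is the relation to be used on natural numbers. -/
def IsOrdSimulation (r : ℕ → ℕ → Prop) (R : Typ [] → Tm [] → Tm [] → Prop) : Prop :=
  ∀ σ s t, R σ s t →
    σ.IsNormal ∧ HasType [] s σ ∧ HasType [] t σ ∧
    ((σ = .nat ∧ ∃ m n : ℕ, s.EvalsTo m ∧ t.EvalsTo n ∧ r m n) ∨
      (∃ τ₁ τ₂ : Typ [], σ = .arrow τ₁ τ₂ ∧
        ∀ q : Tm [], IsFinal τ₁ q → R τ₂ (.app s q) (.app t q)) ∨
      (∃ (κ : Kind) (ρ : Typ [κ]), σ = .all κ ρ ∧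
        ∀ τ : Ty [] κ, R (ρ.inst τ).nf (.tapp s τ) (.tapp t τ)))

/-- The largest relation consistent with the rules. -/
def Ord (r : ℕ → ℕ → Prop) (σ : Typ []) (s t : Tm []) : Prop :=
  ∃ R, IsOrdSimulation r R ∧ R σ s t

/-- `s ≻⁰_σ t`. -/
def Gt0 (σ : Typ []) (s t : Tm []) : Prop := Ord (· > ·) σ s t

/-- `s ≽⁰_σ t`. -/
def Ge0 (σ : Typ []) (s t : Tm []) : Prop := Ord (· ≥ ·) σ s t

/-- `s ≈⁰_σ t`. -/
def Approx0 (σ : Typ []) (s t : Tm []) : Prop := Ge0 σ s t ∧ Ge0 σ t s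

/-- A closure for the free variables declared in `Γ` and `Δ`: closed type constructors for the
type constructor variables and closed terms of the appropriate types for the term variables. -/
structure Closure {Γ : List Kind} (Δ : List (Typ Γ)) where
  tyMap : TSub Γ []
  tmMap : ℕ → Tm []
  typed : ∀ (i : ℕ) (σ : Typ Γ), Δ[i]? = some σ → HasType [] (tmMap i) (σ.sub tyMap)

/-- `C(s)`. -/
def Closure.onTm {Γ : List Kind} {Δ : List (Typ Γ)} (C : Closure Δ) (s : Tm Γ) : Tm [] :=
  (s.tsub C.tyMap).sub C.tmMap

/-- `nf_β(C(σ))`. -/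
noncomputable def Closure.onTy {Γ : List Kind} {Δ : List (Typ Γ)} (C : Closure Δ) (σ : Typ Γ) :
    Typ [] :=
  (σ.sub C.tyMap).nf

/-- `s ≻_σ t`. -/
def Gt {Γ : List Kind} (Δ : List (Typ Γ)) (σ : Typ Γ) (s t : Tm Γ) : Prop :=
  ∀ C : Closure Δ, Gt0 (C.onTy σ) (C.onTm s) (C.onTm t)

/-- `s ≽_σ t`. -/
def Ge {Γ : List Kind} (Δ : List (Typ Γ)) (σ : Typ Γ) (s t : Tm Γ) : Prop :=
  ∀ C : Closure Δ, Ge0 (C.onTy σ) (C.onTm s) (C.onTm t)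

/-- `s ≈_σ t`. -/
def Approx {Γ : List Kind} (Δ : List (Typ Γ)) (σ : Typ Γ) (s t : Tm Γ) : Prop :=
  ∀ C : Closure Δ, Approx0 (C.onTy σ) (C.onTm s) (C.onTm t)

end InterpTerms

namespace InterpTerms

/-! Every clause is an identity or an inequality of natural numbers in disguise. At a closed
β-normal type a term can only be tested by finitely many applications to final terms and type
constructors, ending at type `nat`; such a chain of applications is an observation `Obs`. `ord_iff`
shows that `s` is related to `t` exactly when the value of `E s` is related to the value of `E t`
for every observation `E`. Observations are homomorphisms: they carry `⊕` and `⊗` to addition and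
multiplication and `lift n` to `n` (`Closure.val_oplus`, `Closure.val_otimes`, `Closure.val_lift`).
Hence the semiring laws and the monotonicity properties are inherited from ℕ, pointwise over
closures and observations.

For this to make sense a closed term of type `nat` must have exactly one value. Existence,
`HasType.exists_red_num`, is a reducibility argument in the style of Girard. A candidate is a set of
closed terms that is closed under expansion and under the constants; no strong normalization is
needed, only evaluation to a numeral. Impredicativity is handled by interpreting type constructor
variables by arbitrary candidates (`Ty.valid_interp`, `HasType.mem_interp`). The same induction
yields `flatten_lift_red`, which an induction on the type alone could not, because `flatten` at a
quantified type passes to an instance of its body.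

Uniqueness, `Tm.Red.val_eq`, is confluence. Parallel reduction of terms and types has the triangle
property (`Ty.Par.triangle`, `Tm.Par.triangle`), so joinability is an equivalence relation. It
contains reduction and conversion in types, and it separates distinct numerals (`Tm.Conv.num_inj`).
-/

/-! ## Substitution lemmas -/

/-- The identity substitution. -/
def TSub.ids (Γ : List Kind) : TSub Γ Γ := fun _ x => .var x

def TRen.toSub {Γ Γ' : List Kind} (ρ : TRen Γ Γ') : TSub Γ Γ' := fun κ x => .var (ρ κ x)

/-- Composition of a renaming followed by a substitution. -/
def TRen.thenSub {Γ Γ' Γ'' : List Kind} (ρ : TRen Γ Γ') (θ : TSub Γ' Γ'') : TSub Γ Γ'' :=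
  fun κ x => θ κ (ρ κ x)

def TSub.thenRen {Γ Γ' Γ'' : List Kind} (θ : TSub Γ Γ') (ρ : TRen Γ' Γ'') : TSub Γ Γ'' :=
  fun κ x => (θ κ x).ren ρ

def TSub.comp {Γ Γ' Γ'' : List Kind} (θ : TSub Γ Γ') (θ' : TSub Γ' Γ'') : TSub Γ Γ'' :=
  fun κ x => (θ κ x).sub θ'

/-- The extension of `θ` that maps the most recently declared variable to `τ`. -/
def TSub.cons {Γ Γ' : List Kind} {κ' : Kind} (τ : Ty Γ' κ') (θ : TSub Γ Γ') : TSub (κ' :: Γ) Γ'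
  | _, .zero => τ
  | κ, .succ x => θ κ x

theorem TSub.up_ids (Γ : List Kind) (κ : Kind) : (TSub.ids Γ).up κ = TSub.ids (κ :: Γ) := by
  funext κ' x; cases x <;> rfl

theorem TRen.toSub_up {Γ Γ' : List Kind} (ρ : TRen Γ Γ') (κ : Kind) :
    (ρ.up κ).toSub = ρ.toSub.up κ := by
  funext κ' x; cases x <;> rfl

theorem TRen.thenSub_up {Γ Γ' Γ'' : List Kind} (ρ : TRen Γ Γ') (θ : TSub Γ' Γ'') (κ : Kind) :
    (ρ.up κ).thenSub (θ.up κ) = (ρ.thenSub θ).up κ := by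
  funext κ' x; cases x <;> rfl

/-- Renamings are treated as substitutions by variables, so that laws about renamings follow from
laws about substitutions. -/
theorem Ty.ren_eq_sub {Γ : List Kind} {κ : Kind} (t : Ty Γ κ) :
    ∀ {Γ' : List Kind} (ρ : TRen Γ Γ'), t.ren ρ = t.sub ρ.toSub := by
  induction t with
  | var x => intros; rfl
  | nat => intros; rfl
  | app f a ihf iha => intros; simp [Ty.ren, Ty.sub, ihf, iha]
  | lam b ih => intros; simp [Ty.ren, Ty.sub, ih, TRen.toSub_up]
  | all κ b ih => intros; simp [Ty.ren, Ty.sub, ih, TRen.toSub_up]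
  | arrow a b iha ihb => intros; simp [Ty.ren, Ty.sub, iha, ihb]

theorem Ty.sub_ids {Γ : List Kind} {κ : Kind} (t : Ty Γ κ) : t.sub (TSub.ids Γ) = t := by
  induction t with
  | var x => rfl
  | nat => rfl
  | app f a ihf iha => simp [Ty.sub, ihf, iha]
  | lam b ih => simp [Ty.sub, ih, TSub.up_ids]
  | all κ b ih => simp [Ty.sub, ih, TSub.up_ids]
  | arrow a b iha ihb => simp [Ty.sub, iha, ihb]

/-- Fusion comes in stages: renaming before substitution, then substitution before renaming, then
two substitutions. Each stage supplies the commutation with weakening that the next one needs under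
a binder. -/
theorem Ty.sub_ren {Γ : List Kind} {κ : Kind} (t : Ty Γ κ) :
    ∀ {Γ' Γ'' : List Kind} (ρ : TRen Γ Γ') (θ : TSub Γ' Γ''),
      (t.ren ρ).sub θ = t.sub (ρ.thenSub θ) := by
  induction t with
  | var x => intros; rfl
  | nat => intros; rfl
  | app f a ihf iha => intros; simp [Ty.ren, Ty.sub, ihf, iha]
  | lam b ih => intros; simp [Ty.ren, Ty.sub, ih, TRen.thenSub_up]
  | all κ b ih => intros; simp [Ty.ren, Ty.sub, ih, TRen.thenSub_up]
  | arrow a b iha ihb => intros; simp [Ty.ren, Ty.sub, iha, ihb]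

theorem Ty.ren_wk_up {Γ Γ' : List Kind} {κ : Kind} (t : Ty Γ κ) (ρ : TRen Γ Γ') (κ' : Kind) :
    (t.ren (TRen.wk κ')).ren (ρ.up κ') = (t.ren ρ).ren (TRen.wk κ') := by
  rw [Ty.ren_eq_sub _ (ρ.up κ'), Ty.ren_eq_sub _ (TRen.wk κ' : TRen Γ' _), Ty.sub_ren, Ty.sub_ren]
  rfl

theorem TSub.thenRen_up {Γ Γ' Γ'' : List Kind} (θ : TSub Γ Γ') (ρ : TRen Γ' Γ'') (κ : Kind) :
    (θ.up κ).thenRen (ρ.up κ) = (θ.thenRen ρ).up κ := by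
  funext κ' x
  cases x with
  | zero => rfl
  | succ x => exact Ty.ren_wk_up _ _ _

theorem Ty.ren_sub {Γ : List Kind} {κ : Kind} (t : Ty Γ κ) :
    ∀ {Γ' Γ'' : List Kind} (θ : TSub Γ Γ') (ρ : TRen Γ' Γ''),
      (t.sub θ).ren ρ = t.sub (θ.thenRen ρ) := by
  induction t with
  | var x => intros; rfl
  | nat => intros; rfl
  | app f a ihf iha => intros; simp [Ty.ren, Ty.sub, ihf, iha]
  | lam b ih => intros; simp [Ty.ren, Ty.sub, ih, TSub.thenRen_up]
  | all κ b ih => intros; simp [Ty.ren, Ty.sub, ih, TSub.thenRen_up]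
  | arrow a b iha ihb => intros; simp [Ty.ren, Ty.sub, iha, ihb]

theorem Ty.sub_wk_up {Γ Γ' : List Kind} {κ : Kind} (t : Ty Γ κ) (θ : TSub Γ Γ') (κ' : Kind) :
    (t.ren (TRen.wk κ')).sub (θ.up κ') = (t.sub θ).ren (TRen.wk κ') := by
  rw [Ty.sub_ren, Ty.ren_sub]; rfl

theorem TSub.comp_up {Γ Γ' Γ'' : List Kind} (θ : TSub Γ Γ') (θ' : TSub Γ' Γ'') (κ : Kind) :
    (θ.up κ).comp (θ'.up κ) = (θ.comp θ').up κ := by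
  funext κ' x
  cases x with
  | zero => rfl
  | succ x => exact Ty.sub_wk_up _ _ _

theorem Ty.sub_sub {Γ : List Kind} {κ : Kind} (t : Ty Γ κ) :
    ∀ {Γ' Γ'' : List Kind} (θ : TSub Γ Γ') (θ' : TSub Γ' Γ''),
      (t.sub θ).sub θ' = t.sub (θ.comp θ') := by
  induction t with
  | var x => intros; rfl
  | nat => intros; rfl
  | app f a ihf iha => intros; simp [Ty.sub, ihf, iha]
  | lam b ih => intros; simp [Ty.sub, ih, TSub.comp_up]
  | all κ b ih => intros; simp [Ty.sub, ih, TSub.comp_up]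
  | arrow a b iha ihb => intros; simp [Ty.sub, iha, ihb]

theorem TSub.wk_thenSub_one {Γ : List Kind} {κ : Kind} (τ : Ty Γ κ) :
    (TRen.wk κ).thenSub (TSub.one τ) = TSub.ids Γ := rfl

theorem TSub.up_comp_one {Γ Γ' : List Kind} {κ : Kind} (θ : TSub Γ Γ') (τ : Ty Γ' κ) :
    (θ.up κ).comp (TSub.one τ) = TSub.cons τ θ := by
  funext κ' x
  cases x with
  | zero => rfl
  | succ x =>
    change ((θ _ x).ren (TRen.wk κ)).sub (TSub.one τ) = θ _ x
    rw [Ty.sub_ren, TSub.wk_thenSub_one, Ty.sub_ids]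

theorem TSub.one_comp {Γ Γ' : List Kind} {κ : Kind} (θ : TSub Γ Γ') (τ : Ty Γ κ) :
    (TSub.one τ).comp θ = TSub.cons (τ.sub θ) θ := by
  funext κ' x; cases x <;> rfl

/-- A type β-step after substituting under the binder amounts to extending the substitution. This is
the form in which the reducibility argument meets quantified bodies. -/
theorem Ty.sub_up_inst {Γ Γ' : List Kind} {κ κ' : Kind} (t : Ty (κ' :: Γ) κ) (θ : TSub Γ Γ')
    (τ : Ty Γ' κ') : (t.sub (θ.up κ')).inst τ = t.sub (TSub.cons τ θ) := by
  rw [Ty.inst, Ty.sub_sub, TSub.up_comp_one]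

theorem Ty.inst_sub {Γ Γ' : List Kind} {κ κ' : Kind} (t : Ty (κ' :: Γ) κ) (τ : Ty Γ κ')
    (θ : TSub Γ Γ') : (t.inst τ).sub θ = (t.sub (θ.up κ')).inst (τ.sub θ) := by
  rw [Ty.sub_up_inst, Ty.inst, Ty.sub_sub, TSub.one_comp]

/-- `χ_κ` has no free variables. -/
theorem Ty.sub_chi {Γ : List Kind} (κ : Kind) : ∀ {Γ' : List Kind} (θ : TSub Γ Γ'),
    (Ty.chi κ : Ty Γ κ).sub θ = Ty.chi κ := by
  induction κ generalizing Γ with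
  | star => intros; rfl
  | arr κ₁ κ₂ _ ih => intros; simp [Ty.chi, Ty.sub, ih]

/-! ### Terms -/

theorem Tm.tren_eq_tsub {Γ : List Kind} (s : Tm Γ) :
    ∀ {Γ' : List Kind} (ρ : TRen Γ Γ'), s.tren ρ = s.tsub ρ.toSub := by
  induction s <;> intros <;> simp [Tm.tren, Tm.tsub, Ty.ren_eq_sub, TRen.toSub_up, *]

theorem Tm.tsub_ids {Γ : List Kind} (s : Tm Γ) : s.tsub (TSub.ids Γ) = s := by
  induction s <;> simp [Tm.tsub, Ty.sub_ids, TSub.up_ids, *]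

theorem Tm.tsub_tsub {Γ : List Kind} (s : Tm Γ) :
    ∀ {Γ' Γ'' : List Kind} (θ : TSub Γ Γ') (θ' : TSub Γ' Γ''),
      (s.tsub θ).tsub θ' = s.tsub (θ.comp θ') := by
  induction s <;> intros <;> simp [Tm.tsub, Ty.sub_sub, TSub.comp_up, *]

theorem TSub.wk_comp_up {Γ Γ' : List Kind} (θ : TSub Γ Γ') (κ : Kind) :
    (TRen.wk κ).toSub.comp (θ.up κ) = θ.comp (TRen.wk κ).toSub := by
  funext κ' x
  exact Ty.ren_eq_sub _ _

theorem Tm.tsub_up_twk {Γ Γ' : List Kind} (s : Tm Γ) (θ : TSub Γ Γ') (κ : Kind) :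
    (s.twk κ).tsub (θ.up κ) = (s.tsub θ).twk κ := by
  rw [Tm.twk, Tm.twk, Tm.tren_eq_tsub, Tm.tren_eq_tsub, Tm.tsub_tsub, Tm.tsub_tsub,
    TSub.wk_comp_up]

theorem Tm.tinst_twk {Γ : List Kind} {κ : Kind} (s : Tm Γ) (τ : Ty Γ κ) :
    (s.twk κ).tinst τ = s := by
  rw [Tm.twk, Tm.tinst, Tm.tren_eq_tsub, Tm.tsub_tsub]
  exact Tm.tsub_ids s

theorem Tm.tsub_up_tinst {Γ Γ' : List Kind} {κ : Kind} (s : Tm (κ :: Γ)) (θ : TSub Γ Γ')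
    (τ : Ty Γ' κ) : (s.tsub (θ.up κ)).tinst τ = s.tsub (TSub.cons τ θ) := by
  rw [Tm.tinst, Tm.tsub_tsub, TSub.up_comp_one]

theorem Tm.tinst_tsub {Γ Γ' : List Kind} {κ : Kind} (s : Tm (κ :: Γ)) (τ : Ty Γ κ)
    (θ : TSub Γ Γ') : (s.tinst τ).tsub θ = (s.tsub (θ.up κ)).tinst (τ.sub θ) := by
  rw [Tm.tsub_up_tinst, Tm.tinst, Tm.tsub_tsub, TSub.one_comp]

/-- Term variables and type constructor variables are independent sorts, so operations on them
commute. -/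
theorem Tm.tsub_ren {Γ : List Kind} (s : Tm Γ) :
    ∀ {Γ' : List Kind} (ρ : ℕ → ℕ) (θ : TSub Γ Γ'), (s.ren ρ).tsub θ = (s.tsub θ).ren ρ := by
  induction s <;> intros <;> simp [Tm.tsub, Tm.ren, *]

theorem Tm.tsub_wk {Γ Γ' : List Kind} (s : Tm Γ) (θ : TSub Γ Γ') :
    s.wk.tsub θ = (s.tsub θ).wk := Tm.tsub_ren _ _ _

theorem Tm.twk_ren {Γ : List Kind} (s : Tm Γ) (ρ : ℕ → ℕ) (κ : Kind) :
    (s.ren ρ).twk κ = (s.twk κ).ren ρ := by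
  rw [Tm.twk, Tm.twk, Tm.tren_eq_tsub, Tm.tren_eq_tsub, Tm.tsub_ren]

theorem Tm.ren_eq_sub {Γ : List Kind} (s : Tm Γ) :
    ∀ (ρ : ℕ → ℕ), s.ren ρ = s.sub (fun i => .var (ρ i)) := by
  induction s with
  | abs σ s ih =>
    intro ρ
    simp only [Tm.ren, Tm.sub, ih]
    congr; funext i; cases i <;> rfl
  | _ => intros; simp [Tm.ren, Tm.sub, Tm.twk, Tm.tren, *]

theorem Tm.sub_var {Γ : List Kind} (s : Tm Γ) : s.sub .var = s := by
  induction s with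
  | @abs Γ σ s ih =>
    have : upSub (Tm.var : ℕ → Tm Γ) = .var := by funext i; cases i <;> rfl
    simp only [Tm.sub, this, ih]
  | tabs κ s ih => exact congrArg _ ih
  | _ => simp [Tm.sub, *]

/-- The same staged fusion as for type constructors, now for term variables. -/
theorem Tm.sub_ren {Γ : List Kind} (s : Tm Γ) :
    ∀ (ρ : ℕ → ℕ) (γ : ℕ → Tm Γ), (s.ren ρ).sub γ = s.sub (fun i => γ (ρ i)) := by
  induction s with
  | abs σ s ih =>
    intro ρ γ
    simp only [Tm.ren, Tm.sub, ih]
    congr; funext i; cases i <;> rfl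
  | _ => intros; simp [Tm.ren, Tm.sub, *]

theorem Tm.ren_wk {Γ : List Kind} (s : Tm Γ) (ρ : ℕ → ℕ) :
    s.wk.ren (upRen ρ) = (s.ren ρ).wk := by
  rw [Tm.wk, Tm.wk, Tm.ren_eq_sub (s.ren _) (upRen ρ), Tm.ren_eq_sub (s.ren ρ) Nat.succ,
    Tm.sub_ren, Tm.sub_ren]
  rfl

theorem Tm.ren_sub {Γ : List Kind} (s : Tm Γ) :
    ∀ (γ : ℕ → Tm Γ) (ρ : ℕ → ℕ), (s.sub γ).ren ρ = s.sub (fun i => (γ i).ren ρ) := by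
  induction s with
  | abs σ s ih =>
    intro γ ρ
    simp only [Tm.ren, Tm.sub, ih]
    congr; funext i
    cases i with
    | zero => rfl
    | succ i => exact Tm.ren_wk _ _
  | _ => intros; simp [Tm.ren, Tm.sub, Tm.twk_ren, *]

theorem Tm.sub_wk {Γ : List Kind} (s : Tm Γ) (γ : ℕ → Tm Γ) :
    s.wk.sub (upSub γ) = (s.sub γ).wk := by
  rw [Tm.wk, Tm.wk, Tm.sub_ren, Tm.ren_sub]; rfl

theorem Tm.tsub_sub {Γ : List Kind} (s : Tm Γ) :
    ∀ {Γ' : List Kind} (γ : ℕ → Tm Γ) (θ : TSub Γ Γ'),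
      (s.sub γ).tsub θ = (s.tsub θ).sub (fun i => (γ i).tsub θ) := by
  induction s with
  | abs σ s ih =>
    intro _ γ θ
    simp only [Tm.tsub, Tm.sub, ih]
    congr; funext i
    cases i with
    | zero => rfl
    | succ i => exact Tm.tsub_wk _ _
  | _ => intros; simp [Tm.tsub, Tm.sub, Tm.tsub_up_twk, *]

theorem Tm.sub_twk {Γ : List Kind} (s : Tm Γ) (γ : ℕ → Tm Γ) (κ : Kind) :
    (s.twk κ).sub (fun i => (γ i).twk κ) = (s.sub γ).twk κ := by
  simp only [Tm.twk, Tm.tren_eq_tsub, Tm.tsub_sub]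

theorem Tm.sub_sub {Γ : List Kind} (s : Tm Γ) :
    ∀ (γ δ : ℕ → Tm Γ), (s.sub γ).sub δ = s.sub (fun i => (γ i).sub δ) := by
  induction s with
  | abs σ s ih =>
    intro γ δ
    simp only [Tm.sub, ih]
    congr; funext i
    cases i with
    | zero => rfl
    | succ i => exact Tm.sub_wk _ _
  | _ => intros; simp [Tm.sub, Tm.sub_twk, *]

/-- The extension of `γ` that maps the most recently bound variable to `t`. -/
def consSub {Γ : List Kind} (t : Tm Γ) (γ : ℕ → Tm Γ) : ℕ → Tm Γ
  | 0 => t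
  | i + 1 => γ i

theorem Tm.inst_eq {Γ : List Kind} (s t : Tm Γ) : s.inst t = s.sub (consSub t .var) := by
  rw [Tm.inst]; congr

theorem Tm.inst_wk {Γ : List Kind} (s t : Tm Γ) : s.wk.inst t = s := by
  rw [Tm.inst_eq, Tm.wk, Tm.sub_ren]; exact Tm.sub_var s

theorem Tm.sub_up_inst {Γ : List Kind} (s : Tm Γ) (γ : ℕ → Tm Γ) (t : Tm Γ) :
    (s.sub (upSub γ)).inst t = s.sub (consSub t γ) := by
  rw [Tm.inst_eq, Tm.sub_sub]
  congr; funext i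
  cases i with
  | zero => rfl
  | succ i => change (γ i).wk.sub _ = γ i; rw [← Tm.inst_eq, Tm.inst_wk]

theorem Tm.inst_sub {Γ : List Kind} (s t : Tm Γ) (γ : ℕ → Tm Γ) :
    (s.inst t).sub γ = (s.sub (upSub γ)).inst (t.sub γ) := by
  rw [Tm.sub_up_inst, Tm.inst_eq, Tm.sub_sub]
  congr; funext i; cases i <;> rfl

theorem Tm.inst_tsub {Γ Γ' : List Kind} (s t : Tm Γ) (θ : TSub Γ Γ') :
    (s.inst t).tsub θ = (s.tsub θ).inst (t.tsub θ) := by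
  rw [Tm.inst_eq, Tm.inst_eq, Tm.tsub_sub]
  congr 1; funext i; cases i <;> rfl

theorem Tm.inst_ren {Γ : List Kind} (s t : Tm Γ) (ρ : ℕ → ℕ) :
    (s.inst t).ren ρ = (s.ren (upRen ρ)).inst (t.ren ρ) := by
  rw [Tm.inst_eq, Tm.inst_eq, Tm.ren_sub, Tm.sub_ren]
  congr; funext i; cases i <;> rfl

/-- `s[α := τ][γ]`, where `γ` is weakened under the binder of `α`. -/
theorem Tm.tinst_sub {Γ : List Kind} {κ : Kind} (s : Tm (κ :: Γ)) (τ : Ty Γ κ) (γ : ℕ → Tm Γ) :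
    (s.tinst τ).sub γ = (s.sub (fun i => (γ i).twk κ)).tinst τ := by
  rw [Tm.tinst, Tm.tinst, Tm.tsub_sub]
  congr; funext i; exact (Tm.tinst_twk _ _).symm

theorem Tm.tinst_ren {Γ : List Kind} {κ : Kind} (s : Tm (κ :: Γ)) (τ : Ty Γ κ) (ρ : ℕ → ℕ) :
    (s.tinst τ).ren ρ = (s.ren ρ).tinst τ := by
  rw [Tm.tinst, Tm.tinst, Tm.tsub_ren]

/-! ## Many-step reduction -/

theorem Tm.Equiv.refl {Γ : List Kind} (s : Tm Γ) : s.Equiv s := by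
  induction s with
  | var i => exact .var i
  | num n => exact .num n
  | sym f => exact .sym f
  | abs σ s ih => exact .abs (.refl _) ih
  | tabs κ s ih => exact .tabs κ ih
  | app s t ihs iht => exact .app ihs iht
  | tapp s τ ih => exact .tapp ih (.refl _)

theorem Tm.Equiv.trans {Γ : List Kind} {s t : Tm Γ} (h : s.Equiv t) :
    ∀ {u : Tm Γ}, t.Equiv u → s.Equiv u := by
  induction h with
  | var i => exact id
  | num n => exact id
  | sym f => exact id
  | abs hσ _ ih => intro u h; cases h with | abs hσ' h => exact .abs (.trans _ _ _ hσ hσ') (ih h)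
  | tabs κ _ ih => intro u h; cases h with | tabs _ h => exact .tabs κ (ih h)
  | app _ _ ih ih' => intro u h; cases h with | app h h' => exact .app (ih h) (ih' h')
  | tapp _ hτ ih => intro u h; cases h with | tapp h hτ' => exact .tapp (ih h) (.trans _ _ _ hτ hτ')

/-- One step of reduction or of conversion in types. -/
def Tm.Red₁ {Γ : List Kind} (s t : Tm Γ) : Prop := s.Equiv t ∨ s.PreStep t

/-- Many-step reduction, including conversion in types. -/
def Tm.Red {Γ : List Kind} : Tm Γ → Tm Γ → Prop := Relation.ReflTransGen Tm.Red₁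

theorem Tm.Equiv.red {Γ : List Kind} {s t : Tm Γ} (h : s.Equiv t) : s.Red t := .single (.inl h)

theorem Tm.PreStep.red {Γ : List Kind} {s t : Tm Γ} (h : s.PreStep t) : s.Red t :=
  .single (.inr h)

theorem Tm.Red.appL {Γ : List Kind} {s t : Tm Γ} (h : s.Red t) (u : Tm Γ) :
    (Tm.app s u).Red (.app t u) := by
  refine Relation.ReflTransGen.lift (fun x => Tm.app x u) (fun _ _ h => ?_) _ _ h
  exact h.imp (fun h => .app h (.refl _)) (fun h => .appL _ h)

theorem Tm.Red.appR {Γ : List Kind} {s t : Tm Γ} (h : s.Red t) (u : Tm Γ) :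
    (Tm.app u s).Red (.app u t) := by
  refine Relation.ReflTransGen.lift (fun x => Tm.app u x) (fun _ _ h => ?_) _ _ h
  exact h.imp (fun h => .app (.refl _) h) (fun h => .appR _ h)

theorem Tm.Red.tapp {Γ : List Kind} {κ : Kind} {s t : Tm Γ} (h : s.Red t) (τ : Ty Γ κ) :
    (Tm.tapp s τ).Red (.tapp t τ) := by
  refine Relation.ReflTransGen.lift (fun x => Tm.tapp x τ) (fun _ _ h => ?_) _ _ h
  exact h.imp (fun h => .tapp h (.refl _)) (fun h => .tapp _ h)

theorem Tm.Red.circ {Γ : List Kind} {s s' t t' : Tm Γ} (hs : s.Red s') (ht : t.Red t') (f : Sym)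
    (σ : Typ Γ) : (circ f σ s t).Red (circ f σ s' t') :=
  ((hs.appR _).appL _).trans (ht.appR _)

theorem Tm.Red.flatten {Γ : List Kind} {s s' : Tm Γ} (h : s.Red s') (σ : Typ Γ) :
    (flatten σ s).Red (flatten σ s') := h.appR _

theorem circ_equiv {Γ : List Kind} {σ σ' : Typ Γ} (h : σ.BetaEq σ') (f : Sym) (s t : Tm Γ) :
    (circ f σ s t).Equiv (circ f σ' s t) :=
  .app (.app (.tapp (.refl _) h) (.refl _)) (.refl _)

theorem lift_equiv {Γ : List Kind} {σ σ' : Typ Γ} (h : σ.BetaEq σ') (s : Tm Γ) :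
    (lift σ s).Equiv (lift σ' s) :=
  .app (.tapp (.refl _) h) (.refl _)

theorem flatten_equiv {Γ : List Kind} {σ σ' : Typ Γ} (h : σ.BetaEq σ') (s : Tm Γ) :
    (flatten σ s).Equiv (flatten σ' s) :=
  .app (.tapp (.refl _) h) (.refl _)

/-- `Tm.Step` has conversion in types built into each step, whereas `Tm.Red` allows it as a step of
its own; the latter composes more easily. The two agree on evaluation to numerals. -/
theorem Tm.evalsTo_iff {s : Tm []} {n : ℕ} : s.EvalsTo n ↔ s.Red (.num n) := by
  constructor
  · intro h
    induction h using Relation.ReflTransGen.head_induction_on with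
    | refl => exact .refl
    | head h _ ih =>
      obtain ⟨s', t', h₁, h₂, h₃⟩ := h
      exact (h₁.red.trans h₂.red).trans (h₃.red.trans ih)
  · intro h
    induction h using Relation.ReflTransGen.head_induction_on with
    | refl => exact .refl
    | head h _ ih =>
      rcases h with h | h
      · rcases Relation.ReflTransGen.cases_head ih with rfl | ⟨c, ⟨s', t', h₁, h₂, h₃⟩, hc⟩
        · cases h; exact .refl
        · exact .head ⟨s', t', h.trans h₁, h₂, h₃⟩ hc
      · exact .head ⟨_, _, .refl _, h, .refl _⟩ ih

/-! ### Applied operations -/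

/-- The unfolding rule followed by β at the root: applied to an argument, a sum or product of
functions becomes the sum or product of their values. The three analogues below have the same
purpose. All later arguments use the rules of `⊕`, `⊗` and `lift` at compound types only in this
applied form. -/
theorem circ_arrow_app {Γ : List Kind} {f : Sym} (hf : f = .plus ∨ f = .times) (σ τ : Typ Γ)
    (s t q : Tm Γ) :
    (Tm.app (circ f (.arrow σ τ) s t) q).Red (circ f τ (.app s q) (.app t q)) := by
  refine ((Tm.PreStep.circ_arrow f hf σ τ s t).red.appL q).trans ?_
  have h := Tm.PreStep.beta σ (circ f τ (.app s.wk (.var 0)) (.app t.wk (.var 0))) q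
  rw [show (circ f τ (.app s.wk (.var 0)) (.app t.wk (.var 0))).inst q
    = circ f τ (.app (s.wk.inst q) q) (.app (t.wk.inst q) q) from rfl,
    Tm.inst_wk, Tm.inst_wk] at h
  exact h.red

theorem circ_all_tapp {Γ : List Kind} {f : Sym} (hf : f = .plus ∨ f = .times) {κ : Kind}
    (σ : Typ (κ :: Γ)) (s t : Tm Γ) (τ : Ty Γ κ) :
    (Tm.tapp (circ f (.all κ σ) s t) τ).Red (circ f (σ.inst τ) (.tapp s τ) (.tapp t τ)) := by
  refine ((Tm.PreStep.circ_all f hf κ σ s t).red.tapp τ).trans ?_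
  have h := Tm.PreStep.tbeta (circ f σ (.tapp (s.twk κ) (.var TVar.zero : Ty (κ :: Γ) κ))
    (.tapp (t.twk κ) (.var TVar.zero : Ty (κ :: Γ) κ))) τ
  rw [show (circ f σ (.tapp (s.twk κ) (.var TVar.zero : Ty (κ :: Γ) κ))
      (.tapp (t.twk κ) (.var TVar.zero : Ty (κ :: Γ) κ))).tinst τ
    = circ f (σ.inst τ) (.tapp ((s.twk κ).tinst τ) τ) (.tapp ((t.twk κ).tinst τ) τ) from rfl,
    Tm.tinst_twk, Tm.tinst_twk] at h
  exact h.red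

theorem lift_arrow_app {Γ : List Kind} (σ τ : Typ Γ) (s q : Tm Γ) :
    (Tm.app (lift (.arrow σ τ) s) q).Red (lift τ s) := by
  refine ((Tm.PreStep.lift_arrow σ τ s).red.appL q).trans ?_
  have h := Tm.PreStep.beta σ (lift τ s.wk) q
  rw [show (lift τ s.wk).inst q = lift τ (s.wk.inst q) from rfl, Tm.inst_wk] at h
  exact h.red

theorem lift_all_tapp {Γ : List Kind} {κ : Kind} (σ : Typ (κ :: Γ)) (s : Tm Γ) (τ : Ty Γ κ) :
    (Tm.tapp (lift (.all κ σ) s) τ).Red (lift (σ.inst τ) s) := by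
  refine ((Tm.PreStep.lift_all κ σ s).red.tapp τ).trans ?_
  have h := Tm.PreStep.tbeta (lift σ (s.twk κ)) τ
  rw [show (lift σ (s.twk κ)).tinst τ = lift (σ.inst τ) ((s.twk κ).tinst τ) from rfl,
    Tm.tinst_twk] at h
  exact h.red

/-! ## Reducibility -/

/-- Terms that reduce to a natural number. -/
def NatRed : Set (Tm []) := {s | ∃ n, s.Red (.num n)}

/-- The semantic domains of kinds. -/
def Sem : Kind → Type
  | .star => Set (Tm [])
  | .arr κ₁ κ₂ => Sem κ₁ → Sem κ₂

/-- Reducibility candidates for the type `τ`. -/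
structure IsCandidate (τ : Typ []) (C : Set (Tm [])) : Prop where
  expand : ∀ {s t : Tm []}, s.Red t → t ∈ C → s ∈ C
  circ : ∀ {f : Sym} {s t : Tm []}, f = .plus ∨ f = .times → s ∈ C → t ∈ C → circ f τ s t ∈ C
  lift : ∀ {s : Tm []}, s ∈ NatRed → lift τ s ∈ C
  flatten : ∀ {s : Tm []}, s ∈ C → flatten τ s ∈ NatRed
  flatten_lift : ∀ s : Tm [], (InterpTerms.flatten τ (InterpTerms.lift τ s)).Red s

/-- Candidates at every kind. -/
def Valid : (κ : Kind) → Ty [] κ → Sem κ → Prop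
  | .star, τ, C => IsCandidate τ C
  | .arr κ₁ κ₂, φ, F => ∀ (τ : Ty [] κ₁) (C : Sem κ₁), Valid κ₁ τ C → Valid κ₂ (.app φ τ) (F C)

theorem Ty.BetaEq.appL {Γ : List Kind} {κ₁ κ₂ : Kind} {f f' : Ty Γ (.arr κ₁ κ₂)}
    (h : f.BetaEq f') (a : Ty Γ κ₁) : (Ty.app f a).BetaEq (.app f' a) := by
  induction h with
  | rel _ _ h => exact .rel _ _ (.appL _ h)
  | refl _ => exact .refl _
  | symm _ _ _ ih => exact ih.symm
  | trans _ _ _ _ _ ih ih' => exact ih.trans _ _ _ ih'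

/-- At kind `∗` the type enters a candidate only as the index of a constant, and converting that
index is a reduction in the sense of `Tm.Red`. -/
theorem Valid.of_betaEq : ∀ {κ : Kind} {τ τ' : Ty [] κ} {C : Sem κ},
    τ.BetaEq τ' → Valid κ τ C → Valid κ τ' C
  | .star, _, _, _, h, H =>
    { expand := H.expand
      circ := fun hf hs ht => H.expand (circ_equiv h.symm _ _ _).red (H.circ hf hs ht)
      lift := fun hs => H.expand (lift_equiv h.symm _).red (H.lift hs)
      flatten := fun hs => by
        obtain ⟨n, hn⟩ := H.flatten hs
        exact ⟨n, (flatten_equiv h.symm _).red.trans hn⟩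
      flatten_lift := fun s => ((flatten_equiv h.symm _).red.trans
        ((lift_equiv h.symm s).red.flatten _)).trans (H.flatten_lift s) }
  | .arr _ _, _, _, _, h, H => fun τ C hC => Valid.of_betaEq (h.appL τ) (H τ C hC)

/-- Valuations of type constructor variables. -/
def Env (Γ : List Kind) : Type := ∀ κ : Kind, TVar Γ κ → Sem κ

def Env.cons {Γ : List Kind} {κ' : Kind} (C : Sem κ') (ξ : Env Γ) : Env (κ' :: Γ)
  | _, .zero => C
  | κ, .succ x => ξ κ x

def Env.Valid {Γ : List Kind} (θ : TSub Γ []) (ξ : Env Γ) : Prop :=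
  ∀ (κ : Kind) (x : TVar Γ κ), InterpTerms.Valid κ (θ κ x) (ξ κ x)

theorem Env.Valid.cons {Γ : List Kind} {θ : TSub Γ []} {ξ : Env Γ} (h : ξ.Valid θ) {κ : Kind}
    {τ : Ty [] κ} {C : Sem κ} (hC : InterpTerms.Valid κ τ C) :
    (ξ.cons C).Valid (TSub.cons τ θ) := by
  intro κ x
  cases x with
  | zero => exact hC
  | succ x => exact h _ x

/-- The interpretation of type constructors. -/
def Ty.interp {Γ : List Kind} {κ : Kind} : Ty Γ κ → Env Γ → Sem κ
  | .var x, ξ => ξ _ x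
  | .nat, _ => NatRed
  | .app f a, ξ => f.interp ξ (a.interp ξ)
  | .lam b, ξ => fun C => b.interp (ξ.cons C)
  | .all κ b, ξ => {s | ∀ (τ : Ty [] κ) (C : Sem κ), Valid κ τ C →
      Tm.tapp s τ ∈ (show Set (Tm []) from b.interp (ξ.cons C))}
  | .arrow a b, ξ => {s | ∀ t ∈ (show Set (Tm []) from a.interp ξ),
      Tm.app s t ∈ (show Set (Tm []) from b.interp ξ)}

theorem Ty.interp_ren {Γ : List Kind} {κ : Kind} (t : Ty Γ κ) :
    ∀ {Γ' : List Kind} (ρ : TRen Γ Γ') (ξ : Env Γ'),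
      (t.ren ρ).interp ξ = t.interp (fun κ x => ξ κ (ρ κ x)) := by
  have key : ∀ {Γ Γ' : List Kind} (ρ : TRen Γ Γ') (ξ : Env Γ') {κ : Kind} (C : Sem κ),
      (fun κ' x => ξ.cons C κ' (ρ.up κ κ' x)) = Env.cons C (fun κ x => ξ κ (ρ κ x)) := by
    intro Γ Γ' ρ ξ κ C; funext κ' x; cases x <;> rfl
  induction t with
  | var x => intros; rfl
  | nat => intros; rfl
  | app f a ihf iha => intros; simp [Ty.ren, Ty.interp, ihf, iha]
  | lam b ih => intros; simp [Ty.ren, Ty.interp, ih, key]; rfl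
  | all κ b ih => intros; simp [Ty.ren, Ty.interp, ih, key]; rfl
  | arrow a b iha ihb => intros; simp [Ty.ren, Ty.interp, iha, ihb]; rfl

theorem Ty.interp_sub {Γ : List Kind} {κ : Kind} (t : Ty Γ κ) :
    ∀ {Γ' : List Kind} (θ : TSub Γ Γ') (ξ : Env Γ'),
      (t.sub θ).interp ξ = t.interp (fun κ x => (θ κ x).interp ξ) := by
  have key : ∀ {Γ Γ' : List Kind} (θ : TSub Γ Γ') (ξ : Env Γ') {κ : Kind} (C : Sem κ),
      (fun κ' x => (θ.up κ κ' x).interp (ξ.cons C))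
        = Env.cons C (fun κ x => (θ κ x).interp ξ) := by
    intro Γ Γ' θ ξ κ C; funext κ' x
    cases x with
    | zero => rfl
    | succ x => exact Ty.interp_ren _ _ _
  induction t with
  | var x => intros; rfl
  | nat => intros; rfl
  | app f a ihf iha => intros; simp [Ty.sub, Ty.interp, ihf, iha]
  | lam b ih => intros; simp [Ty.sub, Ty.interp, ih, key]; rfl
  | all κ b ih => intros; simp [Ty.sub, Ty.interp, ih, key]; rfl
  | arrow a b iha ihb => intros; simp [Ty.sub, Ty.interp, iha, ihb]; rfl

theorem Ty.interp_inst {Γ : List Kind} {κ κ' : Kind} (t : Ty (κ' :: Γ) κ) (τ : Ty Γ κ')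
    (ξ : Env Γ) : (t.inst τ).interp ξ = t.interp (ξ.cons (τ.interp ξ)) := by
  rw [Ty.inst, Ty.interp_sub]
  congr; funext κ'' x; cases x <;> rfl

/-- β on type constructors is function application in the semantics, so the interpretation is
literally invariant. The conversion rule of typing rests on this. -/
theorem Ty.Beta.interp_eq {Γ : List Kind} {κ : Kind} {t t' : Ty Γ κ} (h : t.Beta t') :
    ∀ ξ : Env Γ, t.interp ξ = t'.interp ξ := by
  induction h with
  | beta b a => intro ξ; rw [Ty.interp_inst]; rfl
  | appL a _ ih | appR f _ ih | lam _ ih | all κ _ ih | arrowL b _ ih | arrowR a _ ih =>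
    intro ξ; simp [Ty.interp, ih] <;> rfl

theorem Ty.BetaEq.interp_eq {Γ : List Kind} {κ : Kind} {t t' : Ty Γ κ} (h : t.BetaEq t')
    (ξ : Env Γ) : t.interp ξ = t'.interp ξ := by
  induction h with
  | rel _ _ h => exact h.interp_eq ξ
  | refl _ => rfl
  | symm _ _ _ ih => exact ih.symm
  | trans _ _ _ _ _ ih ih' => exact ih.trans ih'

theorem natRed_isCandidate : IsCandidate .nat NatRed where
  expand := fun h ⟨n, hn⟩ => ⟨n, h.trans hn⟩
  circ := by
    rintro f s t hf ⟨n, hn⟩ ⟨m, hm⟩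
    rcases hf with rfl | rfl
    · exact ⟨_, (hn.circ hm _ _).trans (Tm.PreStep.plus_nat n m).red⟩
    · exact ⟨_, (hn.circ hm _ _).trans (Tm.PreStep.times_nat n m).red⟩
  lift := fun ⟨n, hn⟩ => ⟨n, (Tm.PreStep.lift_nat _).red.trans hn⟩
  flatten := fun ⟨n, hn⟩ => ⟨n, (Tm.PreStep.flatten_nat _).red.trans hn⟩
  flatten_lift := fun s => (Tm.PreStep.flatten_nat _).red.trans (Tm.PreStep.lift_nat _).red

/-- `χ_κ` ignores its arguments and ends in `nat`, so constant functions with value `NatRed` serve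
as its semantics. -/
theorem exists_valid_chi : ∀ κ : Kind, ∃ C, Valid κ (Ty.chi κ) C
  | .star => ⟨NatRed, natRed_isCandidate⟩
  | .arr _ κ₂ => by
    obtain ⟨C, hC⟩ := exists_valid_chi κ₂
    refine ⟨fun _ => C, fun τ _ _ => Valid.of_betaEq (.symm _ _ (.rel _ _ ?_)) hC⟩
    have h := Ty.Beta.beta (Ty.chi κ₂) τ
    rwa [Ty.inst, Ty.sub_chi] at h

/-- The induction is on the type constructor with substitution and valuation varying together.
Passing to an instance `b[α := τ]` thus only extends them, even when the instance is larger than the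
quantified type. -/
theorem Ty.valid_interp {Γ : List Kind} {κ : Kind} (t : Ty Γ κ) :
    ∀ (θ : TSub Γ []) (ξ : Env Γ), ξ.Valid θ → Valid κ (t.sub θ) (t.interp ξ) := by
  induction t with
  | var x => intro θ ξ h; exact h _ x
  | nat => intro θ ξ _; exact natRed_isCandidate
  | app f a ihf iha => intro θ ξ h; exact ihf θ ξ h _ _ (iha θ ξ h)
  | lam b ih =>
    intro θ ξ h τ C hC
    refine Valid.of_betaEq (.symm _ _ (.rel _ _ ?_)) (ih (TSub.cons τ θ) _ (h.cons hC))
    rw [← Ty.sub_up_inst]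
    exact .beta _ _
  | all κ b ih =>
    intro θ ξ h
    have ih' : ∀ (τ : Ty [] κ) (C : Sem κ), Valid κ τ C →
        IsCandidate ((b.sub (θ.up κ)).inst τ) (b.interp (ξ.cons C)) := by
      intro τ C hC
      rw [Ty.sub_up_inst]
      exact ih _ _ (h.cons hC)
    -- `flatten` at a quantified type instantiates it at `χ_κ`; any candidate for `χ_κ` will do.
    obtain ⟨X, hX⟩ := exists_valid_chi κ
    exact
      { expand := fun hr ht τ C hC => (ih' τ C hC).expand (hr.tapp τ) (ht τ C hC)
        circ := fun hf hs ht τ C hC => (ih' τ C hC).expand (circ_all_tapp hf _ _ _ _)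
          ((ih' τ C hC).circ hf (hs τ C hC) (ht τ C hC))
        lift := fun hs τ C hC => (ih' τ C hC).expand (lift_all_tapp _ _ _) ((ih' τ C hC).lift hs)
        flatten := fun hs => natRed_isCandidate.expand (Tm.PreStep.flatten_all _ _ _).red
          ((ih' _ X hX).flatten (hs _ X hX))
        flatten_lift := fun s => ((Tm.PreStep.flatten_all _ _ _).red.trans
          ((lift_all_tapp _ _ _).flatten _)).trans ((ih' _ X hX).flatten_lift s) }
  | arrow a b iha ihb =>
    intro θ ξ h
    have ha : IsCandidate _ _ := iha θ ξ h
    have hb : IsCandidate _ _ := ihb θ ξ h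
    -- `flatten` at an arrow type supplies the argument `lift 0`, which must lie in the candidate of
    -- the domain.
    have h0 : Tm.num 0 ∈ NatRed := ⟨0, .refl⟩
    exact
      { expand := fun hr ht q hq => hb.expand (hr.appL q) (ht q hq)
        circ := fun hf hs ht q hq => hb.expand (circ_arrow_app hf _ _ _ _ _)
          (hb.circ hf (hs q hq) (ht q hq))
        lift := fun hs q hq => hb.expand (lift_arrow_app _ _ _ _) (hb.lift hs)
        flatten := fun hs => natRed_isCandidate.expand (Tm.PreStep.flatten_arrow _ _ _).red
          (hb.flatten (hs _ (ha.lift h0)))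
        flatten_lift := fun s => ((Tm.PreStep.flatten_arrow _ _ _).red.trans
          ((lift_arrow_app _ _ _ _).flatten _)).trans (hb.flatten_lift s) }

theorem Sym.type_sub {Γ Γ' : List Kind} (f : Sym) (θ : TSub Γ Γ') :
    (f.type : Typ Γ).sub θ = f.type := by
  cases f <;> rfl

theorem Sym.mem_interp {Γ : List Kind} (f : Sym) (ξ : Env Γ) :
    Tm.sym f ∈ (show Set (Tm []) from (f.type : Typ Γ).interp ξ) := by
  cases f with
  | plus => exact fun τ C hC s hs t ht => IsCandidate.circ hC (.inl rfl) hs ht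
  | times => exact fun τ C hC s hs t ht => IsCandidate.circ hC (.inr rfl) hs ht
  | flatten => exact fun τ C hC s hs => IsCandidate.flatten hC hs
  | lift => exact fun τ C hC s hs => IsCandidate.lift hC hs

/-- The fundamental theorem of reducibility. For abstractions, closure under expansion reduces
membership to that of the β-reduct, which is the body under an extended substitution. -/
theorem HasType.mem_interp {Γ : List Kind} {Δ : List (Typ Γ)} {s : Tm Γ} {σ : Typ Γ}
    (h : HasType Δ s σ) : ∀ (θ : TSub Γ []) (ξ : Env Γ) (γ : ℕ → Tm []), ξ.Valid θ →
    (∀ i τ, Δ[i]? = some τ → γ i ∈ (show Set (Tm []) from τ.interp ξ)) →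
    (s.tsub θ).sub γ ∈ (show Set (Tm []) from σ.interp ξ) := by
  induction h with
  | var hi => intro θ ξ γ _ hγ; exact hγ _ _ hi
  | num n => intro θ ξ γ _ _; exact ⟨n, .refl⟩
  | sym f => intro θ ξ γ _ _; exact f.mem_interp ξ
  | @abs Γ Δ σ τ s _ ih =>
    intro θ ξ γ hξ hγ q hq
    refine IsCandidate.expand (τ.valid_interp θ ξ hξ) (Tm.PreStep.beta _ _ _).red ?_
    rw [Tm.sub_up_inst]
    refine ih θ ξ _ hξ fun i τ' hi => ?_
    cases i with
    | zero => simp only [List.getElem?_cons_zero, Option.some.injEq] at hi; subst hi; exact hq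
    | succ i => exact hγ i τ' hi
  | @tabs Γ Δ κ σ s _ ih =>
    intro θ ξ γ hξ hγ τ C hC
    refine IsCandidate.expand (σ.valid_interp _ _ (hξ.cons hC)) (Tm.PreStep.tbeta _ _).red ?_
    rw [← Tm.tinst_sub, Tm.tsub_up_tinst]
    refine ih _ _ γ (hξ.cons hC) fun i τ' hi => ?_
    rw [List.getElem?_map, Option.map_eq_some_iff] at hi
    obtain ⟨τ'', hi, rfl⟩ := hi
    rw [Ty.interp_ren]
    exact hγ i _ hi
  | app _ _ ihs iht => intro θ ξ γ hξ hγ; exact ihs θ ξ γ hξ hγ _ (iht θ ξ γ hξ hγ)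
  | tapp τ _ ih =>
    intro θ ξ γ hξ hγ
    rw [Ty.interp_inst]
    exact ih θ ξ γ hξ hγ _ _ (τ.valid_interp θ ξ hξ)
  | conv _ hc ih =>
    intro θ ξ γ hξ hγ
    rw [← hc.interp_eq]
    exact ih θ ξ γ hξ hγ

theorem Env.valid_nil (ξ : Env []) : ξ.Valid (TSub.ids []) := fun _ x => nomatch x

/-- Closed terms of type `nat` reduce to natural numbers. -/
theorem HasType.exists_red_num {s : Tm []} (h : HasType [] s .nat) : ∃ n, s.Red (.num n) := by
  have := h.mem_interp (TSub.ids []) (fun _ x => nomatch x) .var (Env.valid_nil _)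
    (fun i τ hi => by simp at hi)
  rwa [Tm.tsub_ids, Tm.sub_var] at this

/-- This is one field of the candidate that interprets `σ`. It is carried through the reducibility
induction because `σ` itself gives no decreasing measure at quantifiers. -/
theorem flatten_lift_red (σ : Typ []) (s : Tm []) : (flatten σ (lift σ s)).Red s := by
  have := σ.valid_interp (TSub.ids []) (fun _ x => nomatch x) (Env.valid_nil _)
  rw [Ty.sub_ids] at this
  exact IsCandidate.flatten_lift this s

/-! ## Confluence -/

/-- Parallel β-reduction of type constructors. -/
inductive Ty.Par : {Γ : List Kind} → {κ : Kind} → Ty Γ κ → Ty Γ κ → Prop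
  | var {Γ : List Kind} {κ : Kind} (x : TVar Γ κ) : Ty.Par (.var x) (.var x)
  | nat {Γ : List Kind} : Ty.Par (.nat : Ty Γ _) .nat
  | app {Γ : List Kind} {κ₁ κ₂ : Kind} {f f' : Ty Γ (Kind.arr κ₁ κ₂)} {a a' : Ty Γ κ₁} :
      Ty.Par f f' → Ty.Par a a' → Ty.Par (.app f a) (.app f' a')
  | lam {Γ : List Kind} {κ₁ κ₂ : Kind} {b b' : Ty (κ₁ :: Γ) κ₂} :
      Ty.Par b b' → Ty.Par (.lam b) (.lam b')
  | all {Γ : List Kind} (κ : Kind) {b b' : Ty (κ :: Γ) Kind.star} :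
      Ty.Par b b' → Ty.Par (.all κ b) (.all κ b')
  | arrow {Γ : List Kind} {a a' b b' : Typ Γ} :
      Ty.Par a a' → Ty.Par b b' → Ty.Par (.arrow a b) (.arrow a' b')
  | beta {Γ : List Kind} {κ₁ κ₂ : Kind} {b b' : Ty (κ₁ :: Γ) κ₂} {a a' : Ty Γ κ₁} :
      Ty.Par b b' → Ty.Par a a' → Ty.Par (.app (.lam b) a) (b'.inst a')

theorem Ty.Par.refl {Γ : List Kind} {κ : Kind} (t : Ty Γ κ) : t.Par t := by
  induction t with
  | var x => exact .var x
  | nat => exact .nat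
  | app f a ihf iha => exact .app ihf iha
  | lam b ih => exact .lam ih
  | all κ b ih => exact .all κ ih
  | arrow a b iha ihb => exact .arrow iha ihb

theorem Ty.Beta.par {Γ : List Kind} {κ : Kind} {t t' : Ty Γ κ} (h : t.Beta t') : t.Par t' := by
  induction h with
  | beta b a => exact .beta (.refl _) (.refl _)
  | appL a _ ih => exact .app ih (.refl _)
  | appR f _ ih => exact .app (.refl _) ih
  | lam _ ih => exact .lam ih
  | all κ _ ih => exact .all κ ih
  | arrowL b _ ih => exact .arrow ih (.refl _)
  | arrowR a _ ih => exact .arrow (.refl _) ih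

theorem Ty.inst_ren {Γ Γ' : List Kind} {κ κ' : Kind} (t : Ty (κ' :: Γ) κ) (τ : Ty Γ κ')
    (ρ : TRen Γ Γ') : (t.inst τ).ren ρ = (t.ren (ρ.up κ')).inst (τ.ren ρ) := by
  simp only [Ty.ren_eq_sub, Ty.inst_sub, TRen.toSub_up]

theorem Ty.Par.ren {Γ : List Kind} {κ : Kind} {t t' : Ty Γ κ} (h : t.Par t') :
    ∀ {Γ' : List Kind} (ρ : TRen Γ Γ'), (t.ren ρ).Par (t'.ren ρ) := by
  induction h with
  | var x => intros; exact .refl _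
  | nat => intros; exact .nat
  | app _ _ ihf iha => intro _ ρ; exact .app (ihf ρ) (iha ρ)
  | lam _ ih => intro _ ρ; exact .lam (ih _)
  | all κ _ ih => intro _ ρ; exact .all κ (ih _)
  | arrow _ _ iha ihb => intro _ ρ; exact .arrow (iha ρ) (ihb ρ)
  | beta _ _ ihb iha => intro _ ρ; rw [Ty.inst_ren]; exact .beta (ihb _) (iha ρ)

def TSub.Par {Γ Γ' : List Kind} (θ θ' : TSub Γ Γ') : Prop :=
  ∀ (κ : Kind) (x : TVar Γ κ), (θ κ x).Par (θ' κ x)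

theorem TSub.Par.refl {Γ Γ' : List Kind} (θ : TSub Γ Γ') : θ.Par θ := fun _ _ => .refl _

theorem TSub.Par.up {Γ Γ' : List Kind} {θ θ' : TSub Γ Γ'} (h : θ.Par θ') (κ : Kind) :
    (θ.up κ).Par (θ'.up κ) := by
  intro κ' x
  cases x with
  | zero => exact .refl _
  | succ x => exact (h _ x).ren _

theorem TSub.Par.one {Γ : List Kind} {κ : Kind} {τ τ' : Ty Γ κ} (h : τ.Par τ') :
    (TSub.one τ).Par (TSub.one τ') := by
  intro κ' x
  cases x with
  | zero => exact h
  | succ x => exact .refl _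

theorem Ty.Par.sub {Γ : List Kind} {κ : Kind} {t t' : Ty Γ κ} (h : t.Par t') :
    ∀ {Γ' : List Kind} {θ θ' : TSub Γ Γ'}, θ.Par θ' → (t.sub θ).Par (t'.sub θ') := by
  induction h with
  | var x => intro _ _ _ h; exact h _ x
  | nat => intros; exact .nat
  | app _ _ ihf iha => intro _ _ _ h; exact .app (ihf h) (iha h)
  | lam _ ih => intro _ _ _ h; exact .lam (ih (h.up _))
  | all κ _ ih => intro _ _ _ h; exact .all κ (ih (h.up _))
  | arrow _ _ iha ihb => intro _ _ _ h; exact .arrow (iha h) (ihb h)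
  | beta _ _ ihb iha => intro _ _ _ h; rw [Ty.inst_sub]; exact .beta (ihb (h.up _)) (iha h)

theorem Ty.Par.inst {Γ : List Kind} {κ κ' : Kind} {t t' : Ty (κ' :: Γ) κ} {τ τ' : Ty Γ κ'}
    (h : t.Par t') (hτ : τ.Par τ') : (t.inst τ).Par (t'.inst τ') :=
  h.sub (.one hτ)

/-- The triangle property: some reduct of `t` is a parallel reduct of all of them. -/
theorem Ty.Par.triangle {Γ : List Kind} {κ : Kind} (t : Ty Γ κ) :
    ∃ c, ∀ u, t.Par u → u.Par c := by
  induction t with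
  | var x => exact ⟨.var x, fun u h => by cases h; exact .refl _⟩
  | nat => exact ⟨.nat, fun u h => by cases h; exact .refl _⟩
  | app f a ihf iha =>
    obtain ⟨f', hf⟩ := ihf
    obtain ⟨a', ha⟩ := iha
    -- The common reduct is the complete development: a redex at the root is contracted, anything
    -- else is treated componentwise.
    by_cases hl : ∃ b, f = .lam b
    · obtain ⟨b, rfl⟩ := hl
      -- Reflexivity makes `f'` a parallel reduct of an abstraction, hence an abstraction. Its body
      -- then has the triangle property for `b`, although the induction hypothesis concerns only
      -- `.lam b`.
      obtain ⟨b', rfl⟩ : ∃ b', f' = .lam b' := by cases hf _ (.refl _) with | lam _ => exact ⟨_, rfl⟩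
      have hb : ∀ b₁, b.Par b₁ → b₁.Par b' := fun b₁ h => by
        cases hf _ (.lam h) with | lam h => exact h
      refine ⟨b'.inst a', fun u h => ?_⟩
      cases h with
      | app h₁ h₂ => cases h₁ with | lam h₁ => exact .beta (hb _ h₁) (ha _ h₂)
      | beta h₁ h₂ => exact (hb _ h₁).inst (ha _ h₂)
    · refine ⟨.app f' a', fun u h => ?_⟩
      cases h with
      | app h₁ h₂ => exact .app (hf _ h₁) (ha _ h₂)
      | beta h₁ h₂ => exact absurd ⟨_, rfl⟩ hl
  | lam b ih =>
    obtain ⟨b', hb⟩ := ih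
    exact ⟨.lam b', fun u h => by cases h with | lam h => exact .lam (hb _ h)⟩
  | all κ b ih =>
    obtain ⟨b', hb⟩ := ih
    exact ⟨.all κ b', fun u h => by cases h with | all _ h => exact .all κ (hb _ h)⟩
  | arrow a b iha ihb =>
    obtain ⟨a', ha⟩ := iha
    obtain ⟨b', hb⟩ := ihb
    exact ⟨.arrow a' b', fun u h => by
      cases h with | arrow h₁ h₂ => exact .arrow (ha _ h₁) (hb _ h₂)⟩

/-- Parallel reduction of terms, including parallel β-reduction in types. -/
inductive Tm.Par : {Γ : List Kind} → Tm Γ → Tm Γ → Prop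
  | var {Γ : List Kind} (i : ℕ) : Tm.Par (.var i : Tm Γ) (.var i)
  | num {Γ : List Kind} (n : ℕ) : Tm.Par (.num n : Tm Γ) (.num n)
  | sym {Γ : List Kind} (f : Sym) : Tm.Par (.sym f : Tm Γ) (.sym f)
  | abs {Γ : List Kind} {σ σ' : Typ Γ} {s s' : Tm Γ} :
      σ.Par σ' → Tm.Par s s' → Tm.Par (.abs σ s) (.abs σ' s')
  | tabs {Γ : List Kind} (κ : Kind) {s s' : Tm (κ :: Γ)} :
      Tm.Par s s' → Tm.Par (.tabs κ s) (.tabs κ s')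
  | app {Γ : List Kind} {s s' t t' : Tm Γ} :
      Tm.Par s s' → Tm.Par t t' → Tm.Par (.app s t) (.app s' t')
  | tapp {Γ : List Kind} {κ : Kind} {s s' : Tm Γ} {τ τ' : Ty Γ κ} :
      Tm.Par s s' → τ.Par τ' → Tm.Par (.tapp s τ) (.tapp s' τ')
  | beta {Γ : List Kind} (σ : Typ Γ) {s s' t t' : Tm Γ} :
      Tm.Par s s' → Tm.Par t t' → Tm.Par (.app (.abs σ s) t) (s'.inst t')
  | tbeta {Γ : List Kind} {κ : Kind} {s s' : Tm (κ :: Γ)} {τ τ' : Ty Γ κ} :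
      Tm.Par s s' → τ.Par τ' → Tm.Par (.tapp (.tabs κ s) τ) (s'.tinst τ')
  | plus_nat {Γ : List Kind} (n m : ℕ) :
      Tm.Par (.app (.app (.tapp (.sym .plus) .nat) (.num n)) (.num m) : Tm Γ) (.num (n + m))
  | times_nat {Γ : List Kind} (n m : ℕ) :
      Tm.Par (.app (.app (.tapp (.sym .times) .nat) (.num n)) (.num m) : Tm Γ) (.num (n * m))
  | circ_arrow {Γ : List Kind} {f : Sym} (hf : f = .plus ∨ f = .times) {σ σ' τ τ' : Typ Γ}
      {s s' t t' : Tm Γ} : σ.Par σ' → τ.Par τ' → Tm.Par s s' → Tm.Par t t' →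
      Tm.Par (.app (.app (.tapp (.sym f) (.arrow σ τ)) s) t)
        (.abs σ' (circ f τ' (.app s'.wk (.var 0)) (.app t'.wk (.var 0))))
  | circ_all {Γ : List Kind} {f : Sym} (hf : f = .plus ∨ f = .times) {κ : Kind}
      {σ σ' : Typ (κ :: Γ)} {s s' t t' : Tm Γ} : σ.Par σ' → Tm.Par s s' → Tm.Par t t' →
      Tm.Par (.app (.app (.tapp (.sym f) (.all κ σ)) s) t)
        (.tabs κ (circ f σ' (.tapp (s'.twk κ) (.var TVar.zero : Ty (κ :: Γ) κ))
          (.tapp (t'.twk κ) (.var TVar.zero : Ty (κ :: Γ) κ))))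
  | flatten_nat {Γ : List Kind} {s s' : Tm Γ} :
      Tm.Par s s' → Tm.Par (.app (.tapp (.sym .flatten) .nat) s) s'
  | flatten_arrow {Γ : List Kind} {σ σ' τ τ' : Typ Γ} {s s' : Tm Γ} :
      σ.Par σ' → τ.Par τ' → Tm.Par s s' →
      Tm.Par (.app (.tapp (.sym .flatten) (.arrow σ τ)) s)
        (flatten τ' (.app s' (lift σ' (.num 0))))
  | flatten_all {Γ : List Kind} {κ : Kind} {σ σ' : Typ (κ :: Γ)} {s s' : Tm Γ} :
      σ.Par σ' → Tm.Par s s' →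
      Tm.Par (.app (.tapp (.sym .flatten) (.all κ σ)) s)
        (flatten (σ'.inst (Ty.chi κ)) (.tapp s' (Ty.chi κ : Ty Γ κ)))
  | lift_nat {Γ : List Kind} {s s' : Tm Γ} :
      Tm.Par s s' → Tm.Par (.app (.tapp (.sym .lift) .nat) s) s'
  | lift_arrow {Γ : List Kind} {σ σ' τ τ' : Typ Γ} {s s' : Tm Γ} :
      σ.Par σ' → τ.Par τ' → Tm.Par s s' →
      Tm.Par (.app (.tapp (.sym .lift) (.arrow σ τ)) s) (.abs σ' (lift τ' s'.wk))
  | lift_all {Γ : List Kind} {κ : Kind} {σ σ' : Typ (κ :: Γ)} {s s' : Tm Γ} :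
      σ.Par σ' → Tm.Par s s' →
      Tm.Par (.app (.tapp (.sym .lift) (.all κ σ)) s) (.tabs κ (lift σ' (s'.twk κ)))

theorem Tm.Par.refl {Γ : List Kind} (s : Tm Γ) : s.Par s := by
  induction s with
  | var i => exact .var i
  | num n => exact .num n
  | sym f => exact .sym f
  | abs σ s ih => exact .abs (.refl _) ih
  | tabs κ s ih => exact .tabs κ ih
  | app s t ihs iht => exact .app ihs iht
  | tapp s τ ih => exact .tapp ih (.refl _)

theorem Tm.PreStep.par {Γ : List Kind} {s t : Tm Γ} (h : s.PreStep t) : s.Par t := by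
  induction h with
  | abs σ _ ih => exact .abs (.refl _) ih
  | tabs κ _ ih => exact .tabs κ ih
  | appR u _ ih => exact .app (.refl _) ih
  | appL u _ ih => exact .app ih (.refl _)
  | tapp τ _ ih => exact .tapp ih (.refl _)
  | beta σ s t => exact .beta σ (.refl _) (.refl _)
  | tbeta s τ => exact .tbeta (.refl _) (.refl _)
  | plus_nat n m => exact .plus_nat n m
  | times_nat n m => exact .times_nat n m
  | circ_arrow f hf σ τ s t => exact .circ_arrow hf (.refl _) (.refl _) (.refl _) (.refl _)
  | circ_all f hf κ σ s t => exact .circ_all hf (.refl _) (.refl _) (.refl _)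
  | flatten_nat s => exact .flatten_nat (.refl _)
  | flatten_arrow σ τ s => exact .flatten_arrow (.refl _) (.refl _) (.refl _)
  | flatten_all κ σ s => exact .flatten_all (.refl _) (.refl _)
  | lift_nat s => exact .lift_nat (.refl _)
  | lift_arrow σ τ s => exact .lift_arrow (.refl _) (.refl _) (.refl _)
  | lift_all κ σ s => exact .lift_all (.refl _) (.refl _)

theorem Tm.Par.circ {Γ : List Kind} {f : Sym} {σ σ' : Typ Γ} {s s' t t' : Tm Γ}
    (hσ : σ.Par σ') (hs : s.Par s') (ht : t.Par t') : (circ f σ s t).Par (circ f σ' s' t') :=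
  .app (.app (.tapp (.sym f) hσ) hs) ht

theorem Tm.Par.lift {Γ : List Kind} {σ σ' : Typ Γ} {s s' : Tm Γ}
    (hσ : σ.Par σ') (hs : s.Par s') : (lift σ s).Par (lift σ' s') :=
  .app (.tapp (.sym _) hσ) hs

theorem Tm.Par.flatten {Γ : List Kind} {σ σ' : Typ Γ} {s s' : Tm Γ}
    (hσ : σ.Par σ') (hs : s.Par s') : (flatten σ s).Par (flatten σ' s') :=
  .app (.tapp (.sym _) hσ) hs

/-- Both the term and the substitution may reduce, as is needed when a contracted redex is compared
with one whose parts were reduced first. -/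
theorem Tm.Par.tsub {Γ : List Kind} {s s' : Tm Γ} (h : s.Par s') :
    ∀ {Γ' : List Kind} {θ θ' : TSub Γ Γ'}, θ.Par θ' → (s.tsub θ).Par (s'.tsub θ') := by
  induction h with
  | var i => intros; exact .var i
  | num n => intros; exact .num n
  | sym f => intros; exact .sym f
  | abs hσ _ ih => intro _ _ _ h; exact .abs (hσ.sub h) (ih h)
  | tabs κ _ ih => intro _ _ _ h; exact .tabs κ (ih (h.up _))
  | app _ _ ih ih' => intro _ _ _ h; exact .app (ih h) (ih' h)
  | tapp _ hτ ih => intro _ _ _ h; exact .tapp (ih h) (hτ.sub h)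
  | beta σ _ _ ih ih' => intro _ _ _ h; rw [Tm.inst_tsub]; exact .beta _ (ih h) (ih' h)
  | tbeta _ hτ ih => intro _ _ _ h; rw [Tm.tinst_tsub]; exact .tbeta (ih (h.up _)) (hτ.sub h)
  | plus_nat n m => intros; exact .plus_nat n m
  | times_nat n m => intros; exact .times_nat n m
  | circ_arrow hf hσ hτ _ _ ih ih' =>
    intro _ _ _ h
    have := Tm.Par.circ_arrow hf (hσ.sub h) (hτ.sub h) (ih h) (ih' h)
    rwa [← Tm.tsub_wk, ← Tm.tsub_wk] at this
  | circ_all hf hσ _ _ ih ih' =>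
    intro _ _ _ h
    have := Tm.Par.circ_all hf (hσ.sub (h.up _)) (ih h) (ih' h)
    rwa [← Tm.tsub_up_twk, ← Tm.tsub_up_twk] at this
  | flatten_nat _ ih => intro _ _ _ h; exact .flatten_nat (ih h)
  | flatten_arrow hσ hτ _ ih =>
    intro _ _ _ h; exact .flatten_arrow (hσ.sub h) (hτ.sub h) (ih h)
  | flatten_all hσ _ ih =>
    intro _ _ θ' h
    have := Tm.Par.flatten_all (hσ.sub (h.up _)) (ih h)
    -- `χ_κ` is closed, so it may be read as the image of itself under `θ'`.
    rwa [← Ty.sub_chi _ θ', ← Ty.inst_sub] at this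
  | lift_nat _ ih => intro _ _ _ h; exact .lift_nat (ih h)
  | lift_arrow hσ hτ _ ih =>
    intro _ _ _ h
    have := Tm.Par.lift_arrow (hσ.sub h) (hτ.sub h) (ih h)
    rwa [← Tm.tsub_wk] at this
  | lift_all hσ _ ih =>
    intro _ _ _ h
    have := Tm.Par.lift_all (hσ.sub (h.up _)) (ih h)
    rwa [← Tm.tsub_up_twk] at this

theorem Tm.Par.twk {Γ : List Kind} {s s' : Tm Γ} (h : s.Par s') (κ : Kind) :
    (s.twk κ).Par (s'.twk κ) := by
  rw [Tm.twk, Tm.twk, Tm.tren_eq_tsub, Tm.tren_eq_tsub]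
  exact h.tsub (.refl _)

theorem Tm.Par.ren {Γ : List Kind} {s s' : Tm Γ} (h : s.Par s') :
    ∀ ρ : ℕ → ℕ, (s.ren ρ).Par (s'.ren ρ) := by
  induction h with
  | var i => intros; exact .var _
  | num n => intros; exact .num n
  | sym f => intros; exact .sym f
  | abs hσ _ ih => intro ρ; exact .abs hσ (ih _)
  | tabs κ _ ih => intro ρ; exact .tabs κ (ih _)
  | app _ _ ih ih' => intro ρ; exact .app (ih ρ) (ih' ρ)
  | tapp _ hτ ih => intro ρ; exact .tapp (ih ρ) hτ
  | beta σ _ _ ih ih' => intro ρ; rw [Tm.inst_ren]; exact .beta _ (ih _) (ih' ρ)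
  | tbeta _ hτ ih => intro ρ; rw [Tm.tinst_ren]; exact .tbeta (ih ρ) hτ
  | plus_nat n m => intros; exact .plus_nat n m
  | times_nat n m => intros; exact .times_nat n m
  | circ_arrow hf hσ hτ _ _ ih ih' =>
    intro ρ
    have := Tm.Par.circ_arrow hf hσ hτ (ih ρ) (ih' ρ)
    rwa [← Tm.ren_wk, ← Tm.ren_wk] at this
  | circ_all hf hσ _ _ ih ih' =>
    intro ρ
    have := Tm.Par.circ_all hf hσ (ih ρ) (ih' ρ)
    rwa [Tm.twk_ren, Tm.twk_ren] at this
  | flatten_nat _ ih => intro ρ; exact .flatten_nat (ih ρ)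
  | flatten_arrow hσ hτ _ ih => intro ρ; exact .flatten_arrow hσ hτ (ih ρ)
  | flatten_all hσ _ ih => intro ρ; exact .flatten_all hσ (ih ρ)
  | lift_nat _ ih => intro ρ; exact .lift_nat (ih ρ)
  | lift_arrow hσ hτ _ ih =>
    intro ρ
    have := Tm.Par.lift_arrow hσ hτ (ih ρ)
    rwa [← Tm.ren_wk] at this
  | lift_all hσ _ ih =>
    intro ρ
    have := Tm.Par.lift_all hσ (ih ρ)
    rwa [Tm.twk_ren] at this

theorem Tm.Par.wk {Γ : List Kind} {s s' : Tm Γ} (h : s.Par s') : s.wk.Par s'.wk := h.ren _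

theorem Tm.Par.sub {Γ : List Kind} {s s' : Tm Γ} (h : s.Par s') :
    ∀ {γ γ' : ℕ → Tm Γ}, (∀ i, (γ i).Par (γ' i)) → (s.sub γ).Par (s'.sub γ') := by
  have up : ∀ {Γ : List Kind} {γ γ' : ℕ → Tm Γ}, (∀ i, (γ i).Par (γ' i)) →
      ∀ i, (upSub γ i).Par (upSub γ' i) := by
    intro Γ γ γ' h i
    cases i with
    | zero => exact .refl _
    | succ i => exact (h i).wk
  induction h with
  | var i => intro _ _ h; exact h i
  | num n => intros; exact .num n
  | sym f => intros; exact .sym f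
  | abs hσ _ ih => intro _ _ h; exact .abs hσ (ih (up h))
  | tabs κ _ ih => intro _ _ h; exact .tabs κ (ih fun i => (h i).twk κ)
  | app _ _ ih ih' => intro _ _ h; exact .app (ih h) (ih' h)
  | tapp _ hτ ih => intro _ _ h; exact .tapp (ih h) hτ
  | beta σ _ _ ih ih' => intro _ _ h; rw [Tm.inst_sub]; exact .beta _ (ih (up h)) (ih' h)
  | tbeta _ hτ ih => intro _ _ h; rw [Tm.tinst_sub]; exact .tbeta (ih fun i => (h i).twk _) hτ
  | plus_nat n m => intros; exact .plus_nat n m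
  | times_nat n m => intros; exact .times_nat n m
  | circ_arrow hf hσ hτ _ _ ih ih' =>
    intro _ _ h
    have := Tm.Par.circ_arrow hf hσ hτ (ih h) (ih' h)
    rwa [← Tm.sub_wk, ← Tm.sub_wk] at this
  | circ_all hf hσ _ _ ih ih' =>
    intro _ _ h
    have := Tm.Par.circ_all hf hσ (ih h) (ih' h)
    rwa [← Tm.sub_twk, ← Tm.sub_twk] at this
  | flatten_nat _ ih => intro _ _ h; exact .flatten_nat (ih h)
  | flatten_arrow hσ hτ _ ih => intro _ _ h; exact .flatten_arrow hσ hτ (ih h)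
  | flatten_all hσ _ ih => intro _ _ h; exact .flatten_all hσ (ih h)
  | lift_nat _ ih => intro _ _ h; exact .lift_nat (ih h)
  | lift_arrow hσ hτ _ ih =>
    intro _ _ h
    have := Tm.Par.lift_arrow hσ hτ (ih h)
    rwa [← Tm.sub_wk] at this
  | lift_all hσ _ ih =>
    intro _ _ h
    have := Tm.Par.lift_all hσ (ih h)
    rwa [← Tm.sub_twk] at this

theorem Tm.Par.inst {Γ : List Kind} {s s' t t' : Tm Γ} (hs : s.Par s') (ht : t.Par t') :
    (s.inst t).Par (s'.inst t') := by
  rw [Tm.inst_eq, Tm.inst_eq]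
  refine hs.sub fun i => ?_
  cases i with
  | zero => exact ht
  | succ i => exact .refl _

theorem Tm.Par.tinst {Γ : List Kind} {κ : Kind} {s s' : Tm (κ :: Γ)} {τ τ' : Ty Γ κ}
    (hs : s.Par s') (hτ : τ.Par τ') : (s.tinst τ).Par (s'.tinst τ') :=
  hs.tsub (.one hτ)

theorem Tm.Par.tapp_sym_inv {Γ : List Kind} {κ : Kind} {f : Sym} {σ : Ty Γ κ} {u : Tm Γ}
    (h : (Tm.tapp (.sym f) σ).Par u) : ∃ σ', u = .tapp (.sym f) σ' ∧ σ.Par σ' := by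
  cases h with
  | tapp h₁ h₂ => cases h₁; exact ⟨_, rfl, h₂⟩

/-- A binary symbol with only one term argument is not a redex, so its reducts keep their shape. -/
theorem Tm.Par.app_circ_inv {Γ : List Kind} {f : Sym} (hf : f = .plus ∨ f = .times)
    {σ : Typ Γ} {a u : Tm Γ} (h : (Tm.app (.tapp (.sym f) σ) a).Par u) :
    ∃ σ' a', u = .app (.tapp (.sym f) σ') a' ∧ σ.Par σ' ∧ a.Par a' := by
  cases h with
  | app h₁ h₂ => obtain ⟨σ', rfl, hσ⟩ := h₁.tapp_sym_inv; exact ⟨_, _, rfl, hσ, h₂⟩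
  -- The remaining rules have `flatten` or `lift` at the head.
  | _ => simp at hf

/-- Application of a symbol `⊕` or `⊗` to a type and one term, with a given common reduct of all
its parallel reducts. -/
theorem Tm.Par.app_circ_triangle {Γ : List Kind} {f : Sym} (hf : f = .plus ∨ f = .times)
    {σ : Typ Γ} {a : Tm Γ} {c : Tm Γ}
    (h : ∀ u, (Tm.app (.tapp (.sym f) σ) a).Par u → u.Par c) :
    ∃ σ' a', (∀ σ₁, σ.Par σ₁ → σ₁.Par σ') ∧ (∀ a₁, a.Par a₁ → a₁.Par a') := by
  obtain ⟨σ', a', rfl, -, -⟩ := (h _ (.refl _)).app_circ_inv hf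
  refine ⟨σ', a', fun σ₁ h₁ => ?_, fun a₁ h₁ => ?_⟩
  · obtain ⟨_, _, he, h', -⟩ := (h _ (.app (.tapp (.sym f) h₁) (.refl _))).app_circ_inv hf
    simp only [Tm.app.injEq, Tm.tapp.injEq, heq_eq_eq, true_and] at he
    rw [he.1]; exact h'
  · obtain ⟨_, _, he, -, h'⟩ := (h _ (.app (.refl _) h₁)).app_circ_inv hf
    simp only [Tm.app.injEq] at he
    rw [he.2]; exact h'

/-- The triangle property for terms. -/
theorem Tm.Par.triangle {Γ : List Kind} (s : Tm Γ) : ∃ c, ∀ u, s.Par u → u.Par c := by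
  induction s with
  | var i => exact ⟨.var i, fun u h => by cases h; exact .refl _⟩
  | num n => exact ⟨.num n, fun u h => by cases h; exact .refl _⟩
  | sym f => exact ⟨.sym f, fun u h => by cases h; exact .refl _⟩
  | abs σ s ih =>
    obtain ⟨σ', hσ⟩ := Ty.Par.triangle σ
    obtain ⟨c, hc⟩ := ih
    exact ⟨.abs σ' c, fun u h => by cases h with | abs h₁ h₂ => exact .abs (hσ _ h₁) (hc _ h₂)⟩
  | tabs κ s ih =>
    obtain ⟨c, hc⟩ := ih
    exact ⟨.tabs κ c, fun u h => by cases h with | tabs _ h => exact .tabs κ (hc _ h)⟩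
  | @tapp Γ κ s τ ih =>
    obtain ⟨τ', hτ⟩ := Ty.Par.triangle τ
    obtain ⟨c, hc⟩ := ih
    by_cases hl : ∃ b : Tm (κ :: Γ), s = .tabs _ b
    · obtain ⟨b, rfl⟩ := hl
      obtain ⟨b', rfl⟩ : ∃ b', c = .tabs _ b' := by
        cases hc _ (.refl _) with | tabs _ _ => exact ⟨_, rfl⟩
      have hb : ∀ b₁, b.Par b₁ → b₁.Par b' := fun b₁ h => by
        cases hc _ (.tabs _ h) with | tabs _ h => exact h
      refine ⟨b'.tinst τ', fun u h => ?_⟩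
      cases h with
      | tapp h₁ h₂ => cases h₁ with | tabs _ h₁ => exact .tbeta (hb _ h₁) (hτ _ h₂)
      | tbeta h₁ h₂ => exact (hb _ h₁).tinst (hτ _ h₂)
    · refine ⟨.tapp c τ', fun u h => ?_⟩
      cases h with
      | tapp h₁ h₂ => exact .tapp (hc _ h₁) (hτ _ h₂)
      | tbeta h₁ h₂ => exact absurd ⟨_, rfl⟩ hl
  | app s t ihs iht =>
    obtain ⟨c, hc⟩ := ihs
    obtain ⟨t', ht⟩ := iht
    by_cases hβ : ∃ σ b, s = .abs σ b
    · obtain ⟨σ, b, rfl⟩ := hβ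
      obtain ⟨σ', b', rfl⟩ : ∃ σ' b', c = .abs σ' b' := by
        cases hc _ (.refl _) with | abs _ _ => exact ⟨_, _, rfl⟩
      have hb : ∀ b₁, b.Par b₁ → b₁.Par b' := fun b₁ h => by
        cases hc _ (.abs (.refl _) h) with | abs _ h => exact h
      refine ⟨b'.inst t', fun u h => ?_⟩
      cases h with
      | app h₁ h₂ => cases h₁ with | abs _ h₁ => exact .beta _ (hb _ h₁) (ht _ h₂)
      -- The cases that follow treat the other kinds of root redex one by one. In each, a reduct
      -- obtained by reducing inside the redex is then contracted, and a reduct already contracted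
      -- is reduced further.
      | beta _ h₁ h₂ => exact (hb _ h₁).inst (ht _ h₂)
    by_cases hpn : ∃ n m, s = .app (.tapp (.sym .plus) .nat) (.num n) ∧ t = .num m
    · obtain ⟨n, m, rfl, rfl⟩ := hpn
      refine ⟨.num (n + m), fun u h => ?_⟩
      cases h with
      | app h₁ h₂ =>
        cases h₂
        obtain ⟨_, _, rfl, hσ, hn⟩ := h₁.app_circ_inv (.inl rfl)
        cases hσ; cases hn; exact .plus_nat n m
      | plus_nat => exact .refl _
    by_cases htn : ∃ n m, s = .app (.tapp (.sym .times) .nat) (.num n) ∧ t = .num m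
    · obtain ⟨n, m, rfl, rfl⟩ := htn
      refine ⟨.num (n * m), fun u h => ?_⟩
      cases h with
      | app h₁ h₂ =>
        cases h₂
        obtain ⟨_, _, rfl, hσ, hn⟩ := h₁.app_circ_inv (.inr rfl)
        cases hσ; cases hn; exact .times_nat n m
      | times_nat => exact .refl _
    by_cases hca : ∃ f σ τ a, (f = .plus ∨ f = .times) ∧ s = .app (.tapp (.sym f) (.arrow σ τ)) a
    · obtain ⟨f, σ, τ, a, hf, rfl⟩ := hca
      -- The induction hypothesis speaks of the partial application, not of its argument `a`; the
      -- triangle property for `a` has to be extracted from it.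
      obtain ⟨-, a', -, ha⟩ := app_circ_triangle hf hc
      obtain ⟨σ', hσ⟩ := Ty.Par.triangle σ
      obtain ⟨τ', hτ⟩ := Ty.Par.triangle τ
      refine ⟨.abs σ' (InterpTerms.circ f τ' (.app a'.wk (.var 0)) (.app t'.wk (.var 0))),
        fun u h => ?_⟩
      cases h with
      | app h₁ h₂ =>
        obtain ⟨_, _, rfl, hστ, h₃⟩ := h₁.app_circ_inv hf
        cases hστ with
        | arrow h₄ h₅ => exact .circ_arrow hf (hσ _ h₄) (hτ _ h₅) (ha _ h₃) (ht _ h₂)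
      | circ_arrow _ h₁ h₂ h₃ h₄ =>
        exact .abs (hσ _ h₁) (.circ (hτ _ h₂) (.app (ha _ h₃).wk (.refl _))
          (.app (ht _ h₄).wk (.refl _)))
    by_cases hcl : ∃ f κ σ a, (f = .plus ∨ f = .times) ∧ s = .app (.tapp (.sym f) (.all κ σ)) a
    · obtain ⟨f, κ, σ, a, hf, rfl⟩ := hcl
      obtain ⟨-, a', -, ha⟩ := app_circ_triangle hf hc
      obtain ⟨σ', hσ⟩ := Ty.Par.triangle σ
      refine ⟨.tabs κ (InterpTerms.circ f σ' (.tapp (a'.twk κ) (.var TVar.zero : Ty (κ :: _) κ))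
          (.tapp (t'.twk κ) (.var TVar.zero : Ty (κ :: _) κ))), fun u h => ?_⟩
      cases h with
      | app h₁ h₂ =>
        obtain ⟨_, _, rfl, hσ', h₃⟩ := h₁.app_circ_inv hf
        cases hσ' with
        | all _ h₄ => exact .circ_all hf (hσ _ h₄) (ha _ h₃) (ht _ h₂)
      | circ_all _ h₁ h₃ h₄ =>
        exact .tabs κ (.circ (hσ _ h₁) (.tapp ((ha _ h₃).twk κ) (.refl _))
          (.tapp ((ht _ h₄).twk κ) (.refl _)))
    by_cases hfn : s = .tapp (.sym .flatten) (.nat : Typ _)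
    · subst hfn
      refine ⟨t', fun u h => ?_⟩
      cases h with
      | app h₁ h₂ =>
        obtain ⟨_, rfl, hσ⟩ := h₁.tapp_sym_inv
        cases hσ; exact .flatten_nat (ht _ h₂)
      | flatten_nat h => exact ht _ h
    by_cases hfa : ∃ σ τ, s = .tapp (.sym .flatten) (.arrow σ τ)
    · obtain ⟨σ, τ, rfl⟩ := hfa
      obtain ⟨σ', hσ⟩ := Ty.Par.triangle σ
      obtain ⟨τ', hτ⟩ := Ty.Par.triangle τ
      refine ⟨InterpTerms.flatten τ' (.app t' (InterpTerms.lift σ' (.num 0))), fun u h => ?_⟩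
      cases h with
      | app h₁ h₂ =>
        obtain ⟨_, rfl, hστ⟩ := h₁.tapp_sym_inv
        cases hστ with
        | arrow h₃ h₄ => exact .flatten_arrow (hσ _ h₃) (hτ _ h₄) (ht _ h₂)
      | flatten_arrow h₁ h₂ h₃ =>
        exact .flatten (hτ _ h₂) (.app (ht _ h₃) (.lift (hσ _ h₁) (.refl _)))
    by_cases hfl : ∃ κ σ, s = .tapp (.sym .flatten) (.all κ σ)
    · obtain ⟨κ, σ, rfl⟩ := hfl
      obtain ⟨σ', hσ⟩ := Ty.Par.triangle σ
      refine ⟨InterpTerms.flatten (σ'.inst (Ty.chi κ)) (.tapp t' (Ty.chi κ : Ty _ κ)),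
        fun u h => ?_⟩
      cases h with
      | app h₁ h₂ =>
        obtain ⟨_, rfl, hσ'⟩ := h₁.tapp_sym_inv
        cases hσ' with
        | all _ h₃ => exact .flatten_all (hσ _ h₃) (ht _ h₂)
      | flatten_all h₁ h₃ =>
        exact .flatten ((hσ _ h₁).inst (.refl _)) (.tapp (ht _ h₃) (.refl _))
    by_cases hln : s = .tapp (.sym .lift) (.nat : Typ _)
    · subst hln
      refine ⟨t', fun u h => ?_⟩
      cases h with
      | app h₁ h₂ =>
        obtain ⟨_, rfl, hσ⟩ := h₁.tapp_sym_inv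
        cases hσ; exact .lift_nat (ht _ h₂)
      | lift_nat h => exact ht _ h
    by_cases hla : ∃ σ τ, s = .tapp (.sym .lift) (.arrow σ τ)
    · obtain ⟨σ, τ, rfl⟩ := hla
      obtain ⟨σ', hσ⟩ := Ty.Par.triangle σ
      obtain ⟨τ', hτ⟩ := Ty.Par.triangle τ
      refine ⟨.abs σ' (InterpTerms.lift τ' t'.wk), fun u h => ?_⟩
      cases h with
      | app h₁ h₂ =>
        obtain ⟨_, rfl, hστ⟩ := h₁.tapp_sym_inv
        cases hστ with
        | arrow h₃ h₄ => exact .lift_arrow (hσ _ h₃) (hτ _ h₄) (ht _ h₂)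
      | lift_arrow h₁ h₂ h₃ => exact .abs (hσ _ h₁) (.lift (hτ _ h₂) (ht _ h₃).wk)
    by_cases hll : ∃ κ σ, s = .tapp (.sym .lift) (.all κ σ)
    · obtain ⟨κ, σ, rfl⟩ := hll
      obtain ⟨σ', hσ⟩ := Ty.Par.triangle σ
      refine ⟨.tabs κ (InterpTerms.lift σ' (t'.twk κ)), fun u h => ?_⟩
      cases h with
      | app h₁ h₂ =>
        obtain ⟨_, rfl, hσ'⟩ := h₁.tapp_sym_inv
        cases hσ' with
        | all _ h₃ => exact .lift_all (hσ _ h₃) (ht _ h₂)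
      | lift_all h₁ h₃ => exact .tabs κ (.lift (hσ _ h₁) ((ht _ h₃).twk κ))
    -- No rule applies at the root, so the componentwise reduct is the common one.
    refine ⟨.app c t', fun u h => ?_⟩
    cases h with
    | app h₁ h₂ => exact .app (hc _ h₁) (ht _ h₂)
    | beta σ _ _ => exact absurd ⟨_, _, rfl⟩ hβ
    | plus_nat n m => exact absurd ⟨_, _, rfl, rfl⟩ hpn
    | times_nat n m => exact absurd ⟨_, _, rfl, rfl⟩ htn
    | circ_arrow hf => exact absurd ⟨_, _, _, _, hf, rfl⟩ hca
    | circ_all hf => exact absurd ⟨_, _, _, _, hf, rfl⟩ hcl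
    | flatten_nat => exact absurd rfl hfn
    | flatten_arrow => exact absurd ⟨_, _, rfl⟩ hfa
    | flatten_all => exact absurd ⟨_, _, rfl⟩ hfl
    | lift_nat => exact absurd rfl hln
    | lift_arrow => exact absurd ⟨_, _, rfl⟩ hla
    | lift_all => exact absurd ⟨_, _, rfl⟩ hll

/-! ### Consequences of confluence. -/

/-- Joinability with respect to parallel reduction. -/
def Tm.Conv {Γ : List Kind} : Tm Γ → Tm Γ → Prop :=
  Relation.Join (Relation.ReflTransGen Tm.Par)

/-- The triangle property gives the diamond property, and this makes joinability transitive. -/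
theorem Tm.conv_equivalence (Γ : List Kind) : Equivalence (Tm.Conv (Γ := Γ)) := by
  refine Relation.equivalence_join_reflTransGen fun a b c hb hc => ?_
  obtain ⟨d, hd⟩ := Tm.Par.triangle a
  exact ⟨d, .single (hd _ hb), .single (hd _ hc)⟩

theorem Tm.Par.conv {Γ : List Kind} {s t : Tm Γ} (h : s.Par t) : s.Conv t :=
  ⟨t, .single h, .refl⟩

theorem Tm.Conv.map {Γ Γ' : List Kind} {s t : Tm Γ} (h : s.Conv t) {F : Tm Γ → Tm Γ'}
    (hF : ∀ a b, a.Par b → (F a).Par (F b)) : (F s).Conv (F t) := by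
  obtain ⟨u, hs, ht⟩ := h
  exact ⟨F u, .lift F hF _ _ hs, .lift F hF _ _ ht⟩

theorem Ty.BetaEq.conv {Γ Γ' : List Kind} {κ : Kind} {σ τ : Ty Γ κ} (h : σ.BetaEq τ)
    {F : Ty Γ κ → Tm Γ'} (hF : ∀ a b, a.Par b → (F a).Par (F b)) : (F σ).Conv (F τ) := by
  have e := Tm.conv_equivalence Γ'
  induction h with
  | rel _ _ h => exact (hF _ _ h.par).conv
  | refl _ => exact e.refl _
  | symm _ _ _ ih => exact e.symm ih
  | trans _ _ _ _ _ ih ih' => exact e.trans ih ih'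

/-- Conversion in types may run backwards along β, but joinability is symmetric and transitive, so
each component can be converted separately. -/
theorem Tm.Equiv.conv {Γ : List Kind} {s t : Tm Γ} (h : s.Equiv t) : s.Conv t := by
  induction h with
  | var i => exact (Tm.conv_equivalence _).refl _
  | num n => exact (Tm.conv_equivalence _).refl _
  | sym f => exact (Tm.conv_equivalence _).refl _
  | abs hσ _ ih =>
    exact (Tm.conv_equivalence _).trans
      (hσ.conv (F := fun σ => Tm.abs σ _) fun _ _ h => .abs h (.refl _))
      (ih.map (F := Tm.abs _) fun _ _ h => .abs (.refl _) h)
  | tabs κ _ ih => exact ih.map (F := Tm.tabs κ) fun _ _ h => .tabs κ h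
  | app _ _ ih ih' =>
    exact (Tm.conv_equivalence _).trans
      (ih.map (F := fun s => Tm.app s _) fun _ _ h => .app h (.refl _))
      (ih'.map (F := Tm.app _) fun _ _ h => .app (.refl _) h)
  | tapp _ hτ ih =>
    exact (Tm.conv_equivalence _).trans
      (ih.map (F := fun s => Tm.tapp s _) fun _ _ h => .tapp h (.refl _))
      (hτ.conv (F := Tm.tapp _) fun _ _ h => .tapp (.refl _) h)

theorem Tm.Red.conv {Γ : List Kind} {s t : Tm Γ} (h : s.Red t) : s.Conv t := by
  have e := Tm.conv_equivalence Γ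
  induction h with
  | refl => exact e.refl _
  | tail _ h ih => exact e.trans ih (h.elim (·.conv) (·.par.conv))

theorem Tm.Par.star_num {Γ : List Kind} {n : ℕ} {t : Tm Γ}
    (h : Relation.ReflTransGen Tm.Par (.num n) t) : t = .num n := by
  induction h with
  | refl => rfl
  | tail _ h ih => subst ih; cases h; rfl

/-- A numeral is its own only parallel reduct, so joinable numerals coincide. -/
theorem Tm.Conv.num_inj {Γ : List Kind} {n m : ℕ} (h : (Tm.num n : Tm Γ).Conv (.num m)) :
    n = m := by
  obtain ⟨u, h₁, h₂⟩ := h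
  have := (Tm.Par.star_num h₁).symm.trans (Tm.Par.star_num h₂)
  simpa using this

/-! ## Typing -/

theorem Ty.Beta.sub {Γ : List Kind} {κ : Kind} {t t' : Ty Γ κ} (h : t.Beta t') :
    ∀ {Γ' : List Kind} (θ : TSub Γ Γ'), (t.sub θ).Beta (t'.sub θ) := by
  induction h with
  | beta b a => intro _ θ; rw [Ty.inst_sub]; exact .beta _ _
  | appL a _ ih => intro _ θ; exact .appL _ (ih θ)
  | appR f _ ih => intro _ θ; exact .appR _ (ih θ)
  | lam _ ih => intro _ θ; exact .lam (ih _)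
  | all κ _ ih => intro _ θ; exact .all κ (ih _)
  | arrowL b _ ih => intro _ θ; exact .arrowL _ (ih θ)
  | arrowR a _ ih => intro _ θ; exact .arrowR _ (ih θ)

theorem Ty.BetaEq.sub {Γ Γ' : List Kind} {κ : Kind} {t t' : Ty Γ κ} (h : t.BetaEq t')
    (θ : TSub Γ Γ') : (t.sub θ).BetaEq (t'.sub θ) := by
  induction h with
  | rel _ _ h => exact .rel _ _ (h.sub θ)
  | refl _ => exact .refl _
  | symm _ _ _ ih => exact ih.symm
  | trans _ _ _ _ _ ih ih' => exact ih.trans _ _ _ ih'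

theorem Ty.betaEq_nf {Γ : List Kind} {κ : Kind} (t : Ty Γ κ) : t.BetaEq t.nf := by
  have h := t.nf_spec.1
  generalize t.nf = u at h
  induction h with
  | refl => exact .refl _
  | tail _ h ih => exact ih.trans _ _ _ (.rel _ _ h)

theorem HasType.tsub {Γ : List Kind} {Δ : List (Typ Γ)} {s : Tm Γ} {σ : Typ Γ}
    (h : HasType Δ s σ) : ∀ {Γ' : List Kind} (θ : TSub Γ Γ'),
    HasType (Δ.map (Ty.sub θ)) (s.tsub θ) (σ.sub θ) := by
  induction h with
  | var hi => intro _ θ; exact .var (by simp [hi])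
  | num n => intros; exact .num n
  | sym f => intro _ θ; rw [Sym.type_sub]; exact .sym f
  | abs _ ih => intro _ θ; exact .abs (ih θ)
  | @tabs Γ Δ κ σ s _ ih =>
    intro _ θ
    refine .tabs ?_
    have := ih (θ.up κ)
    rw [List.map_map] at this ⊢
    -- The context under `Λ` is weakened; weakening and substitution commute once the substitution
    -- is lifted past the new variable.
    rwa [show Ty.ren (TRen.wk κ) ∘ Ty.sub θ = Ty.sub (θ.up κ) ∘ Ty.ren (TRen.wk κ) from
      funext fun t => (Ty.sub_wk_up t θ κ).symm]
  | app _ _ ih ih' => intro _ θ; exact .app (ih θ) (ih' θ)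
  | tapp τ _ ih => intro _ θ; rw [Ty.inst_sub]; exact .tapp _ (ih θ)
  | conv _ hc ih => intro _ θ; exact .conv (ih θ) (hc.sub θ)

theorem HasType.twk {Γ : List Kind} {Δ : List (Typ Γ)} {s : Tm Γ} {σ : Typ Γ}
    (h : HasType Δ s σ) (κ : Kind) :
    HasType (Δ.map (Ty.ren (TRen.wk κ))) (s.twk κ) (σ.ren (TRen.wk κ)) := by
  have := h.tsub (TRen.wk κ).toSub
  rwa [← Tm.tren_eq_tsub, ← Ty.ren_eq_sub,
    show Ty.sub (TRen.wk κ).toSub = (Ty.ren (TRen.wk κ) : Typ Γ → _) from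
      funext fun t => (Ty.ren_eq_sub t _).symm] at this

theorem HasType.ren {Γ : List Kind} {Δ : List (Typ Γ)} {s : Tm Γ} {σ : Typ Γ}
    (h : HasType Δ s σ) : ∀ {Δ' : List (Typ Γ)} (ρ : ℕ → ℕ),
    (∀ i τ, Δ[i]? = some τ → Δ'[ρ i]? = some τ) → HasType Δ' (s.ren ρ) σ := by
  induction h with
  | var hi => intro _ ρ h; exact .var (h _ _ hi)
  | num n => intros; exact .num n
  | sym f => intros; exact .sym f
  | abs _ ih =>
    intro _ ρ h
    refine .abs (ih _ fun i τ hi => ?_)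
    cases i with
    | zero => exact hi
    | succ i => exact h i τ hi
  | tabs _ ih =>
    intro _ ρ h
    refine .tabs (ih _ fun i τ hi => ?_)
    rw [List.getElem?_map, Option.map_eq_some_iff] at hi ⊢
    obtain ⟨τ', hi, rfl⟩ := hi
    exact ⟨τ', h _ _ hi, rfl⟩
  | app _ _ ih ih' => intro _ ρ h; exact .app (ih ρ h) (ih' ρ h)
  | tapp τ _ ih => intro _ ρ h; exact .tapp _ (ih ρ h)
  | conv _ hc ih => intro _ ρ h; exact .conv (ih ρ h) hc

theorem HasType.sub {Γ : List Kind} {Δ : List (Typ Γ)} {s : Tm Γ} {σ : Typ Γ}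
    (h : HasType Δ s σ) : ∀ {Δ' : List (Typ Γ)} (γ : ℕ → Tm Γ),
    (∀ i τ, Δ[i]? = some τ → HasType Δ' (γ i) τ) → HasType Δ' (s.sub γ) σ := by
  induction h with
  | var hi => intro _ γ h; exact h _ _ hi
  | num n => intros; exact .num n
  | sym f => intros; exact .sym f
  | abs _ ih =>
    intro _ γ h
    refine .abs (ih _ fun i τ hi => ?_)
    cases i with
    | zero => exact .var hi
    | succ i => exact (h i τ hi).ren _ fun _ _ h => h
  | tabs _ ih =>
    intro _ γ h
    refine .tabs (ih _ fun i τ hi => ?_)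
    rw [List.getElem?_map, Option.map_eq_some_iff] at hi
    obtain ⟨τ', hi, rfl⟩ := hi
    exact (h _ _ hi).twk _
  | app _ _ ih ih' => intro _ γ h; exact .app (ih γ h) (ih' γ h)
  | tapp τ _ ih => intro _ γ h; exact .tapp _ (ih γ h)
  | conv _ hc ih => intro _ γ h; exact .conv (ih γ h) hc

theorem HasType.oplus {Γ : List Kind} {Δ : List (Typ Γ)} {s t : Tm Γ} {σ : Typ Γ}
    (hs : HasType Δ s σ) (ht : HasType Δ t σ) : HasType Δ (oplus σ s t) σ :=
  .app (.app (.tapp σ (.sym .plus)) hs) ht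

theorem HasType.otimes {Γ : List Kind} {Δ : List (Typ Γ)} {s t : Tm Γ} {σ : Typ Γ}
    (hs : HasType Δ s σ) (ht : HasType Δ t σ) : HasType Δ (otimes σ s t) σ :=
  .app (.app (.tapp σ (.sym .times)) hs) ht

theorem HasType.lift {Γ : List Kind} {Δ : List (Typ Γ)} {s : Tm Γ} (σ : Typ Γ)
    (hs : HasType Δ s .nat) : HasType Δ (lift σ s) σ :=
  .app (.tapp σ (.sym .lift)) hs

theorem HasType.flatten {Γ : List Kind} {Δ : List (Typ Γ)} {s : Tm Γ} {σ : Typ Γ}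
    (hs : HasType Δ s σ) : HasType Δ (flatten σ s) .nat :=
  .app (.tapp σ (.sym .flatten)) hs

theorem HasType.osum {Γ : List Kind} {Δ : List (Typ Γ)} {σ : Typ Γ} {ss : List (Tm Γ)} :
    ∀ {s₁ : Tm Γ}, HasType Δ s₁ σ → (∀ s ∈ ss, HasType Δ s σ) → HasType Δ (osum σ s₁ ss) σ := by
  induction ss with
  | nil => intro _ h _; exact h
  | cons s ss ih =>
    intro _ h hs
    exact ih (h.oplus (hs s (by simp))) fun s' h' => hs s' (by simp [h'])

/-! ## Values of closed terms of type `nat` -/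

open Classical in
/-- The natural number to which `s` reduces. -/
noncomputable def Tm.val (s : Tm []) : ℕ := if h : ∃ n, s.Red (.num n) then h.choose else 0

/-- Confluence enters here: the numeral picked by choice is joinable with `n`. Afterwards every
value is computed by exhibiting one reduction. -/
theorem Tm.Red.val_eq {s : Tm []} {n : ℕ} (h : s.Red (.num n)) : s.val = n := by
  have hex : ∃ n, s.Red (.num n) := ⟨n, h⟩
  rw [Tm.val, dif_pos hex]
  have e := Tm.conv_equivalence []
  exact (e.trans (e.symm hex.choose_spec.conv) h.conv).num_inj

theorem HasType.red_val {s : Tm []} (h : HasType [] s .nat) : s.Red (.num s.val) := by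
  obtain ⟨n, hn⟩ := h.exists_red_num
  rwa [hn.val_eq]

theorem val_num (n : ℕ) : (Tm.num n : Tm []).val = n := Tm.Red.val_eq .refl

theorem val_oplus_nat {s t : Tm []} (hs : HasType [] s .nat) (ht : HasType [] t .nat) :
    (oplus .nat s t).val = s.val + t.val :=
  Tm.Red.val_eq <| ((hs.red_val.circ ht.red_val .plus .nat).trans (Tm.PreStep.plus_nat _ _).red)

theorem val_otimes_nat {s t : Tm []} (hs : HasType [] s .nat) (ht : HasType [] t .nat) :
    (otimes .nat s t).val = s.val * t.val :=
  Tm.Red.val_eq <| ((hs.red_val.circ ht.red_val .times .nat).trans (Tm.PreStep.times_nat _ _).red)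

/-! ## Observations -/

/-- The contexts by which the orderings at a closed type test terms of this type. -/
inductive Obs : Typ [] → (Tm [] → Tm []) → Prop
  | nat : Obs .nat id
  | arrow {τ₁ τ₂ : Typ []} {q : Tm []} {E : Tm [] → Tm []} :
      IsFinal τ₁ q → Obs τ₂ E → Obs (.arrow τ₁ τ₂) (fun s => E (.app s q))
  | all {κ : Kind} {ρ : Typ [κ]} (τ : Ty [] κ) {E : Tm [] → Tm []} :
      Obs (ρ.inst τ).nf E → Obs (.all κ ρ) (fun s => E (.tapp s τ))

theorem Obs.red {σ : Typ []} {E : Tm [] → Tm []} (hE : Obs σ E) :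
    ∀ {s t : Tm []}, s.Red t → (E s).Red (E t) := by
  induction hE with
  | nat => exact id
  | arrow _ _ ih => intro _ _ h; exact ih (h.appL _)
  | all τ _ ih => intro _ _ h; exact ih (h.tapp τ)

theorem Obs.hasType {σ : Typ []} {E : Tm [] → Tm []} (hE : Obs σ E) :
    ∀ {s : Tm []}, HasType [] s σ → HasType [] (E s) .nat := by
  induction hE with
  | nat => exact id
  | arrow hq _ ih => intro _ h; exact ih (h.app hq.1)
  | all τ _ ih => intro _ h; exact ih (.conv (.tapp τ h) (Ty.betaEq_nf _))

/-- Each layer of an observation unfolds `⊕` or `⊗` once at the root, until the operation acts at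
`nat`. The types in `Obs` are normalized after instantiation, whence the conversion in the
quantifier case. -/
theorem Obs.circ {f : Sym} (hf : f = .plus ∨ f = .times) {σ : Typ []} {E : Tm [] → Tm []}
    (hE : Obs σ E) : ∀ s t : Tm [], (E (circ f σ s t)).Red (circ f .nat (E s) (E t)) := by
  induction hE with
  | nat => intros; exact .refl
  | arrow _ hE ih => intro s t; exact (hE.red (circ_arrow_app hf _ _ _ _ _)).trans (ih _ _)
  | all τ hE ih =>
    intro s t
    exact (hE.red ((circ_all_tapp hf _ _ _ _).trans
      (circ_equiv (Ty.betaEq_nf _) _ _ _).red)).trans (ih _ _)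

theorem Obs.lift {σ : Typ []} {E : Tm [] → Tm []} (hE : Obs σ E) :
    ∀ s : Tm [], (E (lift σ s)).Red s := by
  induction hE with
  | nat => intro s; exact (Tm.PreStep.lift_nat s).red
  | arrow _ hE ih => intro s; exact (hE.red (lift_arrow_app _ _ _ _)).trans (ih _)
  | all τ hE ih =>
    intro s
    exact (hE.red ((lift_all_tapp _ _ _).trans (lift_equiv (Ty.betaEq_nf _) _).red)).trans (ih _)

/-- Neither a variable nor an application. -/
def Ty.IsIntro {Γ : List Kind} {κ : Kind} : Ty Γ κ → Prop
  | .var _ => False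
  | .app _ _ => False
  | _ => True

/-- A neutral type constructor has a variable at its head, which a closed one lacks. Hence the only
closed normal types are `nat`, arrows and quantified types. The emptiness of the context is an
equation so that the induction can run over the indexed family. -/
theorem Ty.IsNormal.isIntro {Γ : List Kind} {κ : Kind} (t : Ty Γ κ) :
    Γ = [] → t.IsNormal → t.IsIntro := by
  induction t with
  | var x => rintro rfl _; exact nomatch x
  | app f a ihf _ =>
    intro hΓ h
    have hi := ihf hΓ h.2.1
    cases f with
    | var | app => exact hi.elim
    | lam b => exact (h.1 trivial).elim
  | _ => intros; trivial

/-- The ordering is a greatest fixed point and can be refuted only after finitely many tests.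
Observations are exactly these finite tests. Instantiation may go on forever, as for `∀α. α` at
itself, but a path that never reaches `nat` imposes no condition on numbers. -/
theorem ord_iff {r : ℕ → ℕ → Prop} {σ : Typ []} (hσ : σ.IsNormal) {s t : Tm []}
    (hs : HasType [] s σ) (ht : HasType [] t σ) :
    Ord r σ s t ↔ ∀ E, Obs σ E → r (E s).val (E t).val := by
  constructor
  · rintro ⟨R, hR, h⟩ E hE
    clear hσ hs ht
    induction hE generalizing s t with
    | nat =>
      obtain ⟨-, -, -, ⟨-, m, n, hm, hn, hr⟩ | ⟨_, _, h, -⟩ | ⟨_, _, h, -⟩⟩ := hR _ _ _ h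
      · rw [Tm.evalsTo_iff] at hm hn
        rwa [id, id, hm.val_eq, hn.val_eq]
      · cases h
      · cases h
    | arrow hq _ ih =>
      obtain ⟨-, -, -, ⟨h, -⟩ | ⟨_, _, h, h'⟩ | ⟨_, _, h, -⟩⟩ := hR _ _ _ h
      · cases h
      · cases h; exact ih (h' _ hq)
      · cases h
    | all τ _ ih =>
      obtain ⟨-, -, -, ⟨h, -⟩ | ⟨_, _, h, -⟩ | ⟨_, _, h, h'⟩⟩ := hR _ _ _ h
      · cases h
      · cases h
      · cases h; exact ih (h' τ)
  · intro h
    -- Observational comparison is itself a simulation: a test applied after one application or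
    -- instantiation is a test of the original pair.
    refine ⟨fun σ s t => σ.IsNormal ∧ HasType [] s σ ∧ HasType [] t σ ∧
      ∀ E, Obs σ E → r (E s).val (E t).val, ?_, hσ, hs, ht, h⟩
    rintro σ s t ⟨hσ, hs, ht, h⟩
    refine ⟨hσ, hs, ht, ?_⟩
    have hi := hσ.isIntro σ rfl
    cases σ with
    | var | app => exact hi.elim
    | nat =>
      exact .inl ⟨rfl, _, _, Tm.evalsTo_iff.2 hs.red_val, Tm.evalsTo_iff.2 ht.red_val, h _ .nat⟩
    | arrow τ₁ τ₂ =>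
      exact .inr (.inl ⟨_, _, rfl, fun q hq =>
        ⟨hσ.2, hs.app hq.1, ht.app hq.1, fun E hE => h _ (.arrow hq hE)⟩⟩)
    | all κ ρ =>
      exact .inr (.inr ⟨_, _, rfl, fun τ => ⟨(Ty.nf_spec _).2, .conv (.tapp τ hs) (Ty.betaEq_nf _),
        .conv (.tapp τ ht) (Ty.betaEq_nf _), fun E hE => h _ (.all τ hE)⟩⟩)

/-! ## Closures -/

section Closure

variable {Γ : List Kind} {Δ : List (Typ Γ)} {σ : Typ Γ} {s t : Tm Γ}

theorem Closure.betaEq_onTy (C : Closure Δ) (σ : Typ Γ) :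
    (σ.sub C.tyMap).BetaEq (C.onTy σ) := Ty.betaEq_nf _

theorem Closure.hasType_sub (C : Closure Δ) (hs : HasType Δ s σ) :
    HasType [] (C.onTm s) (σ.sub C.tyMap) := by
  refine (hs.tsub C.tyMap).sub C.tmMap fun i τ hi => ?_
  rw [List.getElem?_map, Option.map_eq_some_iff] at hi
  obtain ⟨τ', hi, rfl⟩ := hi
  exact C.typed i τ' hi

theorem Closure.hasType (C : Closure Δ) (hs : HasType Δ s σ) :
    HasType [] (C.onTm s) (C.onTy σ) :=
  .conv (C.hasType_sub hs) (C.betaEq_onTy σ)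

/-- The value of the closure of `s` under the observation `E`. -/
noncomputable def Closure.val (C : Closure Δ) (E : Tm [] → Tm []) (s : Tm Γ) : ℕ :=
  (E (C.onTm s)).val

variable {C : Closure Δ} {E : Tm [] → Tm []}

/-- The index of `⊕` in the closure is the substituted type. It is first converted to its normal
form, at which the observation is defined; the observation then passes inside and the two sides
evaluate to numerals. -/
theorem Closure.val_oplus (hE : Obs (C.onTy σ) E) (hs : HasType Δ s σ) (ht : HasType Δ t σ) :
    C.val E (oplus σ s t) = C.val E s + C.val E t :=
  Tm.Red.val_eq <| ((((hE.red (circ_equiv (C.betaEq_onTy σ) _ _ _).red).trans (hE.circ (.inl rfl) _ _)).trans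
    ((hE.hasType (C.hasType hs)).red_val.circ (hE.hasType (C.hasType ht)).red_val _ _)).trans
      (Tm.PreStep.plus_nat _ _).red)

theorem Closure.val_otimes (hE : Obs (C.onTy σ) E) (hs : HasType Δ s σ) (ht : HasType Δ t σ) :
    C.val E (otimes σ s t) = C.val E s * C.val E t :=
  Tm.Red.val_eq <| ((((hE.red (circ_equiv (C.betaEq_onTy σ) _ _ _).red).trans (hE.circ (.inr rfl) _ _)).trans
    ((hE.hasType (C.hasType hs)).red_val.circ (hE.hasType (C.hasType ht)).red_val _ _)).trans
      (Tm.PreStep.times_nat _ _).red)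

theorem Closure.val_lift (hE : Obs (C.onTy σ) E) (hs : HasType Δ s .nat) :
    C.val E (lift σ s) = (C.onTm s).val :=
  Tm.Red.val_eq <| (((hE.red (lift_equiv (C.betaEq_onTy σ) _).red).trans (hE.lift _)).trans
    (C.hasType_sub hs).red_val)

theorem Closure.val_lift_num (hE : Obs (C.onTy σ) E) (n : ℕ) :
    C.val E (lift σ (.num n)) = n :=
  (Closure.val_lift hE (.num n)).trans (val_num n)

theorem Closure.val_flatten_lift (hE : Obs (C.onTy .nat) E) (σ : Typ Γ)
    (hs : HasType Δ s .nat) : C.val E (flatten σ (lift σ s)) = C.val E s :=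
  Tm.Red.val_eq <| ((hE.red (flatten_lift_red _ _)).trans (hE.hasType (C.hasType hs)).red_val)

theorem Closure.val_osum (hE : Obs (C.onTy σ) E) {ss : List (Tm Γ)} :
    ∀ {s₁ : Tm Γ}, HasType Δ s₁ σ → (∀ s ∈ ss, HasType Δ s σ) →
      C.val E (osum σ s₁ ss) = C.val E s₁ + (ss.map (C.val E)).sum := by
  induction ss with
  | nil => intros; rfl
  | cons s ss ih =>
    intro s₁ h hs
    have h' := hs s (by simp)
    rw [osum, List.foldl_cons, ← osum, ih (h.oplus h') fun s' h' => hs s' (by simp [h']),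
      Closure.val_oplus hE h h', List.map_cons, List.sum_cons, add_assoc]

/-- Together with `ge_iff` and `approx_iff`, this turns all that remains into arithmetic of values.
-/
theorem gt_iff (hs : HasType Δ s σ) (ht : HasType Δ t σ) :
    Gt Δ σ s t ↔ ∀ (C : Closure Δ) (E : Tm [] → Tm []), Obs (C.onTy σ) E →
      C.val E s > C.val E t :=
  forall_congr' fun C => ord_iff (Ty.nf_spec _).2 (C.hasType hs) (C.hasType ht)

theorem ge_iff (hs : HasType Δ s σ) (ht : HasType Δ t σ) :
    Ge Δ σ s t ↔ ∀ (C : Closure Δ) (E : Tm [] → Tm []), Obs (C.onTy σ) E →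
      C.val E s ≥ C.val E t :=
  forall_congr' fun C => ord_iff (Ty.nf_spec _).2 (C.hasType hs) (C.hasType ht)

/-- Antisymmetry of `≤` on ℕ, applied to each observation. -/
theorem approx_iff (hs : HasType Δ s σ) (ht : HasType Δ t σ) :
    Approx Δ σ s t ↔ ∀ (C : Closure Δ) (E : Tm [] → Tm []), Obs (C.onTy σ) E →
      C.val E s = C.val E t := by
  have h : Approx Δ σ s t ↔ Ge Δ σ s t ∧ Ge Δ σ t s := forall_and
  rw [h, ge_iff hs ht, ge_iff ht hs]
  exact ⟨fun ⟨h, h'⟩ C E hE => le_antisymm (h' C E hE) (h C E hE),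
    fun h => ⟨fun C E hE => (h C E hE).ge, fun C E hE => (h C E hE).le⟩⟩

end Closure

/-- The surplus terms of the longer list can only increase its sum, since values are natural
numbers. -/
theorem sum_map_le_sum_map {α : Type*} (f : α → ℕ) : ∀ as bs : List α, bs.length ≤ as.length →
    (∀ (i : ℕ) (a b : α), as[i]? = some a → bs[i]? = some b → f b ≤ f a) →
    (bs.map f).sum ≤ (as.map f).sum
  | _, [], _, _ => by simp
  | [], _ :: _, h, _ => by simp at h
  | a :: as, b :: bs, h, H => by
    simp only [List.map_cons, List.sum_cons]
    exact add_le_add (H 0 a b rfl rfl) (sum_map_le_sum_map f as bs (by simpa using h)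
      fun i a b ha hb => H (i + 1) a b ha hb)

end InterpTerms

/-! ### The theorem, by arithmetic of values. -/

open InterpTerms

theorem mainTheorem6 {Γ : List InterpTerms.Kind} (Δ : List (InterpTerms.Typ Γ))
    (σ : InterpTerms.Typ Γ) :
    open InterpTerms in
    -- commutativity, associativity, distributivity, neutral elements
    (∀ s t u : Tm Γ, HasType Δ s σ → HasType Δ t σ → HasType Δ u σ →
      Approx Δ σ (oplus σ s t) (oplus σ t s) ∧
      Approx Δ σ (otimes σ s t) (otimes σ t s) ∧
      Approx Δ σ (oplus σ s (oplus σ t u)) (oplus σ (oplus σ s t) u) ∧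
      Approx Δ σ (otimes σ s (otimes σ t u)) (otimes σ (otimes σ s t) u) ∧
      Approx Δ σ (otimes σ s (oplus σ t u)) (oplus σ (otimes σ s t) (otimes σ s u)) ∧
      Approx Δ σ (oplus σ (lift σ (.num 0)) s) s ∧
      Approx Δ σ (otimes σ (lift σ (.num 1)) s) s) ∧
    -- `lift` and `flatten`, on natural numbers and on arbitrary terms of type `nat`
    (∀ n m : ℕ,
      Approx Δ σ (lift σ (.num (n + m))) (oplus σ (lift σ (.num n)) (lift σ (.num m))) ∧
      Approx Δ σ (lift σ (.num (n * m))) (otimes σ (lift σ (.num n)) (lift σ (.num m))) ∧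
      Approx Δ .nat (flatten σ (lift σ (.num n))) (.num n)) ∧
    (∀ a b : Tm Γ, HasType Δ a .nat → HasType Δ b .nat →
      Approx Δ σ (lift σ (oplus .nat a b)) (oplus σ (lift σ a) (lift σ b)) ∧
      Approx Δ σ (lift σ (otimes .nat a b)) (otimes σ (lift σ a) (lift σ b)) ∧
      Approx Δ .nat (flatten σ (lift σ a)) a) ∧
    -- sums dominate their parts
    (∀ s t : Tm Γ, HasType Δ s σ → HasType Δ t σ →
      Ge Δ σ (oplus σ s t) s ∧
      Ge Δ σ (oplus σ s t) t ∧
      ∀ n : ℕ, 0 < n →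
        Gt Δ σ (oplus σ s (lift σ (.num n))) s ∧
        Gt Δ σ (oplus σ (lift σ (.num n)) t) t) ∧
    -- monotonicity
    (∀ s t u : Tm Γ, HasType Δ s σ → HasType Δ t σ → HasType Δ u σ →
      (Ge Δ σ s t →
        Ge Δ σ (oplus σ s u) (oplus σ t u) ∧
        Ge Δ σ (oplus σ u s) (oplus σ u t) ∧
        Ge Δ σ (otimes σ s u) (otimes σ t u) ∧
        Ge Δ σ (otimes σ u s) (otimes σ u t)) ∧
      (Gt Δ σ s t →
        Gt Δ σ (oplus σ s u) (oplus σ t u) ∧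
        Gt Δ σ (oplus σ u s) (oplus σ u t) ∧
        (Ge Δ σ u (lift σ (.num 1)) →
          Gt Δ σ (otimes σ s u) (otimes σ t u) ∧
          Gt Δ σ (otimes σ u s) (otimes σ u t)))) ∧
    -- absolute positiveness: sums `a₁ ⊕ ⋯ ⊕ aₙ` and `b₁ ⊕ ⋯ ⊕ bₖ` with `1 ≤ k ≤ n`
    (∀ (s t a₁ b₁ : Tm Γ) (as bs : List (Tm Γ)),
      HasType Δ s σ → HasType Δ t σ → HasType Δ a₁ σ → HasType Δ b₁ σ →
      (∀ a ∈ as, HasType Δ a σ) → (∀ b ∈ bs, HasType Δ b σ) →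
      Approx Δ σ s (osum σ a₁ as) → Approx Δ σ t (osum σ b₁ bs) →
      bs.length ≤ as.length →
      Ge Δ σ a₁ b₁ →
      (∀ (i : ℕ) (a b : Tm Γ), as[i]? = some a → bs[i]? = some b → Ge Δ σ a b) →
      Ge Δ σ s t ∧ (Gt Δ σ a₁ b₁ → Gt Δ σ s t)) := by
  refine ⟨fun s t u hs ht hu => ?_, fun n m => ?_, fun a b ha hb => ?_, fun s t hs ht => ?_,
    fun s t u hs ht hu => ?_, fun s t a₁ b₁ as bs hs ht ha₁ hb₁ has hbs hsa htb hl h₁ hi => ?_⟩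
  · have l0 : HasType Δ (lift σ (.num 0)) σ := .lift σ (.num 0)
    have l1 : HasType Δ (lift σ (.num 1)) σ := .lift σ (.num 1)
    refine ⟨?_, ?_, ?_, ?_, ?_, ?_, ?_⟩
    · rw [approx_iff (hs.oplus ht) (ht.oplus hs)]
      intro C E hE
      rw [Closure.val_oplus hE hs ht, Closure.val_oplus hE ht hs, add_comm]
    · rw [approx_iff (hs.otimes ht) (ht.otimes hs)]
      intro C E hE
      rw [Closure.val_otimes hE hs ht, Closure.val_otimes hE ht hs, mul_comm]
    · rw [approx_iff (hs.oplus (ht.oplus hu)) ((hs.oplus ht).oplus hu)]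
      intro C E hE
      rw [Closure.val_oplus hE hs (ht.oplus hu), Closure.val_oplus hE ht hu,
        Closure.val_oplus hE (hs.oplus ht) hu, Closure.val_oplus hE hs ht, add_assoc]
    · rw [approx_iff (hs.otimes (ht.otimes hu)) ((hs.otimes ht).otimes hu)]
      intro C E hE
      rw [Closure.val_otimes hE hs (ht.otimes hu), Closure.val_otimes hE ht hu,
        Closure.val_otimes hE (hs.otimes ht) hu, Closure.val_otimes hE hs ht, mul_assoc]
    · rw [approx_iff (hs.otimes (ht.oplus hu)) ((hs.otimes ht).oplus (hs.otimes hu))]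
      intro C E hE
      rw [Closure.val_otimes hE hs (ht.oplus hu), Closure.val_oplus hE ht hu,
        Closure.val_oplus hE (hs.otimes ht) (hs.otimes hu), Closure.val_otimes hE hs ht,
        Closure.val_otimes hE hs hu, mul_add]
    · rw [approx_iff (l0.oplus hs) hs]
      intro C E hE
      rw [Closure.val_oplus hE l0 hs, Closure.val_lift_num hE, zero_add]
    · rw [approx_iff (l1.otimes hs) hs]
      intro C E hE
      rw [Closure.val_otimes hE l1 hs, Closure.val_lift_num hE, one_mul]
  · have l : ∀ k, HasType Δ (lift σ (.num k)) σ := fun k => .lift σ (.num k)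
    refine ⟨?_, ?_, ?_⟩
    · rw [approx_iff (l _) ((l n).oplus (l m))]
      intro C E hE
      simp only [Closure.val_oplus hE (l n) (l m), Closure.val_lift_num hE]
    · rw [approx_iff (l _) ((l n).otimes (l m))]
      intro C E hE
      simp only [Closure.val_otimes hE (l n) (l m), Closure.val_lift_num hE]
    · rw [approx_iff (l n).flatten (.num n)]
      exact fun C E hE => Closure.val_flatten_lift hE σ (.num n)
  · have l : ∀ {c : Tm Γ}, HasType Δ c .nat → HasType Δ (lift σ c) σ := fun h => h.lift σ
    refine ⟨?_, ?_, ?_⟩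
    · rw [approx_iff (l (ha.oplus hb)) ((l ha).oplus (l hb))]
      intro C E hE
      rw [Closure.val_oplus hE (l ha) (l hb), Closure.val_lift hE ha, Closure.val_lift hE hb,
        Closure.val_lift hE (ha.oplus hb)]
      exact val_oplus_nat (C.hasType_sub ha) (C.hasType_sub hb)
    · rw [approx_iff (l (ha.otimes hb)) ((l ha).otimes (l hb))]
      intro C E hE
      rw [Closure.val_otimes hE (l ha) (l hb), Closure.val_lift hE ha, Closure.val_lift hE hb,
        Closure.val_lift hE (ha.otimes hb)]
      exact val_otimes_nat (C.hasType_sub ha) (C.hasType_sub hb)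
    · rw [approx_iff (l ha).flatten ha]
      exact fun C E hE => Closure.val_flatten_lift hE σ ha
  · refine ⟨?_, ?_, fun n hn => ?_⟩
    · rw [ge_iff (hs.oplus ht) hs]
      intro C E hE
      rw [Closure.val_oplus hE hs ht]
      exact Nat.le_add_right _ _
    · rw [ge_iff (hs.oplus ht) ht]
      intro C E hE
      rw [Closure.val_oplus hE hs ht]
      exact Nat.le_add_left _ _
    · have l : HasType Δ (lift σ (.num n)) σ := .lift σ (.num n)
      rw [gt_iff (hs.oplus l) hs, gt_iff (l.oplus ht) ht]
      refine ⟨fun C E hE => ?_, fun C E hE => ?_⟩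
      · rw [Closure.val_oplus hE hs l, Closure.val_lift_num hE]
        exact Nat.lt_add_of_pos_right hn
      · rw [Closure.val_oplus hE l ht, Closure.val_lift_num hE]
        exact Nat.lt_add_of_pos_left hn
  · rw [ge_iff hs ht, gt_iff hs ht]
    refine ⟨fun h => ?_, fun h => ?_⟩
    · rw [ge_iff (hs.oplus hu) (ht.oplus hu), ge_iff (hu.oplus hs) (hu.oplus ht),
        ge_iff (hs.otimes hu) (ht.otimes hu), ge_iff (hu.otimes hs) (hu.otimes ht)]
      refine ⟨fun C E hE => ?_, fun C E hE => ?_, fun C E hE => ?_, fun C E hE => ?_⟩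
      · rw [Closure.val_oplus hE hs hu, Closure.val_oplus hE ht hu]
        exact Nat.add_le_add_right (h C E hE) _
      · rw [Closure.val_oplus hE hu hs, Closure.val_oplus hE hu ht]
        exact Nat.add_le_add_left (h C E hE) _
      · rw [Closure.val_otimes hE hs hu, Closure.val_otimes hE ht hu]
        exact Nat.mul_le_mul_right _ (h C E hE)
      · rw [Closure.val_otimes hE hu hs, Closure.val_otimes hE hu ht]
        exact Nat.mul_le_mul_left _ (h C E hE)
    · rw [gt_iff (hs.oplus hu) (ht.oplus hu), gt_iff (hu.oplus hs) (hu.oplus ht),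
        gt_iff (hs.otimes hu) (ht.otimes hu), gt_iff (hu.otimes hs) (hu.otimes ht),
        ge_iff hu (.lift σ (.num 1))]
      refine ⟨fun C E hE => ?_, fun C E hE => ?_, fun hu1 => ?_⟩
      · rw [Closure.val_oplus hE hs hu, Closure.val_oplus hE ht hu]
        exact Nat.add_lt_add_right (h C E hE) _
      · rw [Closure.val_oplus hE hu hs, Closure.val_oplus hE hu ht]
        exact Nat.add_lt_add_left (h C E hE) _
      -- Every observation sends `lift 1` to `1`, so the assumption on `u` makes all of its values
      -- positive; this is what strict monotonicity of multiplication requires.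
      · have hpos : ∀ (C : Closure Δ) (E : Tm [] → Tm []), Obs (C.onTy σ) E → 0 < C.val E u := by
          intro C E hE
          have := hu1 C E hE
          rwa [Closure.val_lift_num hE] at this
        refine ⟨fun C E hE => ?_, fun C E hE => ?_⟩
        · rw [Closure.val_otimes hE hs hu, Closure.val_otimes hE ht hu]
          exact Nat.mul_lt_mul_of_pos_right (h C E hE) (hpos C E hE)
        · rw [Closure.val_otimes hE hu hs, Closure.val_otimes hE hu ht]
          exact Nat.mul_lt_mul_of_pos_left (h C E hE) (hpos C E hE)
  · rw [approx_iff hs (ha₁.osum has)] at hsa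
    rw [approx_iff ht (hb₁.osum hbs)] at htb
    rw [ge_iff ha₁ hb₁] at h₁
    rw [ge_iff hs ht, gt_iff ha₁ hb₁, gt_iff hs ht]
    -- The head summands are kept apart, because only they become strict in the second claim; the
    -- tails are compared weakly in both.
    have tail : ∀ (C : Closure Δ) (E : Tm [] → Tm []), Obs (C.onTy σ) E →
        (bs.map (C.val E)).sum ≤ (as.map (C.val E)).sum := fun C E hE =>
      sum_map_le_sum_map _ as bs hl fun i a b ha hb =>
        (ge_iff (has a (List.mem_of_getElem? ha)) (hbs b (List.mem_of_getElem? hb))).1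
          (hi i a b ha hb) C E hE
    refine ⟨fun C E hE => ?_, fun h₁ C E hE => ?_⟩
    · rw [hsa C E hE, htb C E hE, Closure.val_osum hE ha₁ has, Closure.val_osum hE hb₁ hbs]
      exact Nat.add_le_add (h₁ C E hE) (tail C E hE)
    · rw [hsa C E hE, htb C E hE, Closure.val_osum hE ha₁ has, Closure.val_osum hE hb₁ hbs]
      exact Nat.add_lt_add_of_lt_of_le (h₁ C E hE) (tail C E hE)
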